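/- For a unit vector $|\psi\rangle\in\mathbb{C}^2\otimes\mathbb{C}^2$ let $C(|\psi\rangle)=\sqrt{2(1-\mathrm{Tr}\,\rho_1^2)}$, where $\rho_1$ is the partial trace of $|\psi\rangle\langle\psi|$ over the second factor. For a two-qubit density matrix $\sigma$ let $C(\sigma)=\inf\sum_i p_i\,C(|\phi_i\rangle)$, where the infimum runs over all finite decompositions $\sigma=\sum_i p_i|\phi_i\rangle\langle\phi_i|$ into unit vectors $|\phi_i\rangle$ with $p_i\ge 0$ and $\sum_i p_i=1$ (concurrence). For a density matrix $\rho$ on $\mathbb{C}^2\otimes\mathbb{C}^2\otimes\mathbb{C}^2$, pure or mixed, with two-qubit reduced density matrices $\rho_{AB},\rho_{AC},\rho_{BC}$, put $sC(\rho)=C(\rho_{AB})+C(\rho_{AC})+C(\rho_{BC})$, and let $|W\rangle=\frac{1}{\sqrt3}(|001\rangle+|010\rangle+|100\rangle)$. Then for every such $\rho$ one has $sC(\rho)\le 2$. Moreover, $sC(\rho)=2$ if and only if there are unitary $2\times 2$ matrices $U_1,U_2,U_3$ with $$\rho=(U_1\otimes U_2\otimes U_3)\,|W\rangle\langle W|\,(U_1\otimes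 U_2\otimes U_3)^{\dagger}.$$ -/

import Mathlib

open scoped ComplexOrder Kronecker Matrix

noncomputable section

/-- The basis labels of one qubit. -/
abbrev Qubit : Type := Fin 2

/-- A density matrix: positive semidefinite with trace one. -/
structure IsDensityMatrix {ι : Type*} [Fintype ι] (ρ : Matrix ι ι ℂ) : Prop where
  posSemidef : ρ.PosSemidef
  trace_eq_one : ρ.trace = 1

/-- `ψ` is a unit vector of the Hilbert space with orthonormal basis labelled by `ι`. -/
def IsPureState {ι : Type*} [Fintype ι] (ψ : ι → ℂ) : Prop :=
  ∑ i, ‖ψ i‖ ^ 2 = 1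

/-- The rank-one operator `|ψ⟩⟨ψ|`. -/
def ketBra {ι : Type*} (ψ : ι → ℂ) : Matrix ι ι ℂ :=
  Matrix.vecMulVec ψ (star ψ)

/-- Partial trace over the second factor of a bipartite system. -/
def traceSecond {α β : Type*} [Fintype β] (ρ : Matrix (α × β) (α × β) ℂ) : Matrix α α ℂ :=
  fun a a' => ∑ b, ρ (a, b) (a', b)

/-- Concurrence of a bipartite pure state: `√(2 (1 - Tr ρ_A²))`,
where `ρ_A` is the reduced state of the first party. -/
def pureConcurrence {α β : Type*} [Fintype α] [Fintype β] (ψ : α × β → ℂ) : ℝ :=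
  Real.sqrt (2 * (1 - ((traceSecond (ketBra ψ) * traceSecond (ketBra ψ)).trace).re))

/-- `{(p i, φ i)}` is a decomposition of `ρ` into pure states. -/
structure IsPureDecomposition {ι : Type*} [Fintype ι] (ρ : Matrix ι ι ℂ) {k : ℕ}
    (p : Fin k → ℝ) (φ : Fin k → ι → ℂ) : Prop where
  nonneg : ∀ i, 0 ≤ p i
  sum_eq_one : ∑ i, p i = 1
  isPureState : ∀ i, IsPureState (φ i)
  eq_sum : ρ = ∑ i, (p i : ℂ) • ketBra (φ i)

/-- Concurrence of a bipartite mixed state: the convex roof of the pure-state concurrence,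
over all finite decompositions into pure states. -/
def concurrence {α β : Type*} [Fintype α] [Fintype β] (ρ : Matrix (α × β) (α × β) ℂ) : ℝ :=
  sInf {c : ℝ | ∃ (k : ℕ) (p : Fin k → ℝ) (φ : Fin k → α × β → ℂ),
    IsPureDecomposition ρ p φ ∧ c = ∑ i, p i * pureConcurrence (φ i)}

/-- The basis labels of three qubits `A`, `B`, `C`, in this order. -/
abbrev ThreeQubit : Type := Qubit × (Qubit × Qubit)

/-- The reduced state `ρ_AB` (trace over `C`). -/
def reducedAB (ρ : Matrix ThreeQubit ThreeQubit ℂ) : Matrix (Qubit × Qubit) (Qubit × Qubit) ℂ :=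
  fun x y => ∑ c, ρ (x.1, x.2, c) (y.1, y.2, c)

/-- The reduced state `ρ_AC` (trace over `B`). -/
def reducedAC (ρ : Matrix ThreeQubit ThreeQubit ℂ) : Matrix (Qubit × Qubit) (Qubit × Qubit) ℂ :=
  fun x y => ∑ b, ρ (x.1, b, x.2) (y.1, b, y.2)

/-- The reduced state `ρ_BC` (trace over `A`). -/
def reducedBC (ρ : Matrix ThreeQubit ThreeQubit ℂ) : Matrix (Qubit × Qubit) (Qubit × Qubit) ℂ :=
  fun x y => ∑ a, ρ (a, x.1, x.2) (a, y.1, y.2)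

/-- `sC(ρ) = C(ρ_AB) + C(ρ_AC) + C(ρ_BC)`. -/
def sumConcurrence (ρ : Matrix ThreeQubit ThreeQubit ℂ) : ℝ :=
  concurrence (reducedAB ρ) + concurrence (reducedAC ρ) + concurrence (reducedBC ρ)

/-- The W state `(|001⟩ + |010⟩ + |100⟩) / √3`. -/
def wState : ThreeQubit → ℂ :=
  fun x => if x = (0, 0, 1) ∨ x = (0, 1, 0) ∨ x = (1, 0, 0) then ((1 / Real.sqrt 3 : ℝ) : ℂ) else 0

/-- `ρ` and `σ` are equivalent under local unitary transformations:
`ρ = (U₁ ⊗ U₂ ⊗ U₃) σ (U₁ ⊗ U₂ ⊗ U₃)†`. -/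
def LocalUnitaryEquiv (ρ σ : Matrix ThreeQubit ThreeQubit ℂ) : Prop :=
  ∃ U₁ ∈ Matrix.unitaryGroup Qubit ℂ, ∃ U₂ ∈ Matrix.unitaryGroup Qubit ℂ,
    ∃ U₃ ∈ Matrix.unitaryGroup Qubit ℂ,
      ρ = (U₁ ⊗ₖ (U₂ ⊗ₖ U₃)) * σ * (U₁ ⊗ₖ (U₂ ⊗ₖ U₃))ᴴ

end

/-! Every way of writing a marginal as a sum of rank-one operators bounds its concurrence above by
the sum of the `spinFlip` moduli. These bounds add up over sums of states, so the upper bound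
reduces to pure vectors (`HasRoof`, `TotalRoof`).

For a pure ψ, the pencil of the two slices of C contains a singular matrix. Local rotations
therefore kill the amplitudes 011, 101, 111 (`exists_local_canonical`). Decomposing the marginals
along basis columns then gives at most 2(|χ000χ110| + |χ010χ100| + |χ001χ100| + |χ001χ010|), which
is at most 2‖ψ‖². Equality forces χ000 = χ110 = 0 and three equal moduli, that is, a W-type vector
(`exists_totalRoof_ketBra`). The spectral theorem gives sC ≤ 2 for mixed states.

For equality it remains to exclude rank at least two. Two orthogonal vectors of equal weight may be
replaced by any unitary rotation of the pair, so if no roof beat the bound, their whole span would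
be W-type. Taking one of them to be W, the identities in `WInvariants` along the line W + t f force
f = b|011⟩ + c|101⟩ + d|110⟩ with unit moduli and b ≠ c. Such planes are not ruled out; instead,
mixing columns of W and f lowers the AB weight from 4 to 2|b + c| < 4
(`exists_lt_totalRoof_wVec_add`).

Conversely, each W marginal has no |11⟩ population, so every decomposition is supported off |11⟩ and
its weight is controlled by a single coherence (`two_thirds_le_sum_of_decomposition`). -/

/-! ### Two-qubit pure concurrence as a determinant. -/

/-- Twice the determinant of the coefficient matrix of `v`; its modulus is the concurrence of a
unit vector `v`. -/
def spinFlip (v : Qubit × Qubit → ℂ) : ℂ :=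
  2 * (v (0, 0) * v (1, 1) - v (0, 1) * v (1, 0))

/-- Tr ρ₁² = (Tr ρ₁)² − 2 det ρ₁ for a 2×2 matrix, and det ρ₁ is the squared modulus of the
determinant of the coefficients. -/
lemma pureConcurrence_eq_norm_spinFlip (v : Qubit × Qubit → ℂ) (hv : IsPureState v) :
    pureConcurrence v = ‖spinFlip v‖ := by
  have h1 : ∑ i, ‖v i‖ ^ 2 = 1 := hv
  rw [Fintype.sum_prod_type] at h1
  simp only [Fin.sum_univ_two, Complex.sq_norm, Complex.normSq_apply] at h1
  unfold pureConcurrence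
  rw [← Real.sqrt_sq (norm_nonneg (spinFlip v)), Complex.sq_norm]
  congr 1
  simp only [spinFlip, Matrix.trace, Matrix.diag, Matrix.mul_apply, traceSecond, ketBra,
    Matrix.vecMulVec_apply, Fin.sum_univ_two, Pi.star_apply, Complex.normSq_apply,
    Complex.star_def, Complex.add_re, Complex.mul_re, Complex.add_im, Complex.mul_im,
    Complex.conj_re, Complex.conj_im, Complex.sub_re, Complex.sub_im, Complex.re_ofNat,
    Complex.im_ofNat]
  linear_combination -2 * (1 + ((v (0, 0)).re ^ 2 + (v (0, 0)).im ^ 2 + (v (0, 1)).re ^ 2 +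
    (v (0, 1)).im ^ 2 + (v (1, 0)).re ^ 2 + (v (1, 0)).im ^ 2 + (v (1, 1)).re ^ 2 +
    (v (1, 1)).im ^ 2)) * h1

lemma spinFlip_smul (c : ℂ) (v : Qubit × Qubit → ℂ) : spinFlip (c • v) = c ^ 2 * spinFlip v := by
  simp [spinFlip]; ring

lemma ketBra_smul {ι : Type*} (c : ℂ) (v : ι → ℂ) :
    ketBra (c • v) = ((‖c‖ ^ 2 : ℝ) : ℂ) • ketBra v := by
  ext i j
  simp only [ketBra, Matrix.vecMulVec_apply, Pi.smul_apply, Pi.star_apply, Matrix.smul_apply,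
    smul_eq_mul, star_mul']
  rw [Complex.ofReal_pow, ← Complex.mul_conj']
  simp only [Complex.star_def]
  ring

lemma exists_isPureState_smul {ι : Type*} [Fintype ι] [DecidableEq ι] [Nonempty ι] (v : ι → ℂ) :
    ∃ φ : ι → ℂ, IsPureState φ ∧ v = ((Real.sqrt (∑ i, ‖v i‖ ^ 2) : ℝ) : ℂ) • φ := by
  have h0 : 0 ≤ ∑ i, ‖v i‖ ^ 2 := Finset.sum_nonneg fun i _ => by positivity
  rcases h0.eq_or_lt with h | h
  -- The zero vector has no direction; any unit vector serves, with weight zero.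
  · refine ⟨Pi.single (Classical.arbitrary ι) 1, ?_, ?_⟩
    · unfold IsPureState
      rw [Finset.sum_eq_single (Classical.arbitrary ι)] <;> simp +contextual
    · have hv : v = 0 := by
        funext i
        have := (Finset.sum_eq_zero_iff_of_nonneg (fun i _ => by positivity)).1 h.symm i
          (Finset.mem_univ i)
        simpa using this
      simp [hv]
  · set r := Real.sqrt (∑ i, ‖v i‖ ^ 2) with hr
    have hr0 : 0 < r := Real.sqrt_pos.2 h
    have hr2 : r ^ 2 = ∑ i, ‖v i‖ ^ 2 := Real.sq_sqrt h0
    refine ⟨((r⁻¹ : ℝ) : ℂ) • v, ?_, ?_⟩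
    · unfold IsPureState
      simp only [Pi.smul_apply, smul_eq_mul, norm_mul, mul_pow, Complex.norm_real, norm_inv,
        Real.norm_eq_abs, abs_of_pos hr0]
      rw [← Finset.mul_sum, ← hr2]
      field_simp
    · rw [smul_smul, ← Complex.ofReal_mul, mul_inv_cancel₀ hr0.ne']
      simp

lemma trace_ketBra {ι : Type*} [Fintype ι] (v : ι → ℂ) :
    (ketBra v).trace = ((∑ i, ‖v i‖ ^ 2 : ℝ) : ℂ) := by
  simp [ketBra, Matrix.trace, Matrix.vecMulVec_apply, Complex.mul_conj']

/-! ### Upper bounds from decompositions. -/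

/-- `σ` is a sum of (unnormalised) rank-one operators of total spin-flip weight at most `c`. -/
def HasRoof (σ : Matrix (Qubit × Qubit) (Qubit × Qubit) ℂ) (c : ℝ) : Prop :=
  ∃ (ι : Type) (_ : Fintype ι) (v : ι → Qubit × Qubit → ℂ),
    σ = ∑ i, ketBra (v i) ∧ ∑ i, ‖spinFlip (v i)‖ ≤ c

/-- Both `ketBra` and the modulus of `spinFlip` scale by the squared norm, so squared norms become
the probabilities without changing the weight. -/
lemma HasRoof.exists_isPureDecomposition {σ : Matrix (Qubit × Qubit) (Qubit × Qubit) ℂ} {c : ℝ}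
    (h : HasRoof σ c) (htr : σ.trace = 1) :
    ∃ (k : ℕ) (p : Fin k → ℝ) (φ : Fin k → Qubit × Qubit → ℂ),
      IsPureDecomposition σ p φ ∧ ∑ i, p i * pureConcurrence (φ i) ≤ c := by
  obtain ⟨ι, _, v, hσ, hc⟩ := h
  choose φ hφ hv using fun i => exists_isPureState_smul (v i)
  let e := (Fintype.equivFin ι).symm
  have hn : ∀ i, 0 ≤ ∑ x, ‖v i x‖ ^ 2 := fun i => Finset.sum_nonneg fun x _ => by positivity
  have hket : ∀ i, ketBra (v i) = ((∑ x, ‖v i x‖ ^ 2 : ℝ) : ℂ) • ketBra (φ i) := by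
    intro i
    conv_lhs => rw [hv i, ketBra_smul]
    rw [Complex.norm_real, Real.norm_eq_abs, sq_abs, Real.sq_sqrt (hn i)]
  have hsf : ∀ i, ‖spinFlip (v i)‖ = (∑ x, ‖v i x‖ ^ 2) * ‖spinFlip (φ i)‖ := by
    intro i
    conv_lhs => rw [hv i, spinFlip_smul]
    rw [norm_mul, norm_pow, Complex.norm_real, Real.norm_eq_abs, sq_abs, Real.sq_sqrt (hn i)]
  refine ⟨Fintype.card ι, fun i => ∑ x, ‖v (e i) x‖ ^ 2, fun i => φ (e i), ⟨fun i => hn _, ?_,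
    fun i => hφ _, ?_⟩, ?_⟩
  · rw [e.sum_comp (fun i => ∑ x, ‖v i x‖ ^ 2)]
    rw [hσ, Matrix.trace_sum] at htr
    simp only [trace_ketBra] at htr
    exact_mod_cast htr
  · rw [e.sum_comp (fun i => ((∑ x, ‖v i x‖ ^ 2 : ℝ) : ℂ) • ketBra (φ i)), hσ]
    exact Finset.sum_congr rfl fun i _ => hket i
  · rw [e.sum_comp (fun i => (∑ x, ‖v i x‖ ^ 2) * pureConcurrence (φ i))]
    refine le_trans (le_of_eq (Finset.sum_congr rfl fun i _ => ?_)) hc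
    rw [pureConcurrence_eq_norm_spinFlip _ (hφ i), hsf]

lemma pureConcurrence_nonneg {α β : Type*} [Fintype α] [Fintype β] (ψ : α × β → ℂ) :
    0 ≤ pureConcurrence ψ := Real.sqrt_nonneg _

lemma HasRoof.concurrence_le {σ : Matrix (Qubit × Qubit) (Qubit × Qubit) ℂ} {c : ℝ}
    (h : HasRoof σ c) (htr : σ.trace = 1) : concurrence σ ≤ c := by
  obtain ⟨k, p, φ, hd, hc⟩ := h.exists_isPureDecomposition htr
  refine le_trans (csInf_le ⟨0, ?_⟩ ⟨k, p, φ, hd, rfl⟩) hc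
  rintro _ ⟨k, p, φ, hd, rfl⟩
  exact Finset.sum_nonneg fun i _ => mul_nonneg (hd.nonneg i) (pureConcurrence_nonneg _)

lemma HasRoof.add {σ τ : Matrix (Qubit × Qubit) (Qubit × Qubit) ℂ} {c d : ℝ}
    (h : HasRoof σ c) (h' : HasRoof τ d) : HasRoof (σ + τ) (c + d) := by
  obtain ⟨ι, _, v, hσ, hc⟩ := h
  obtain ⟨κ, _, w, hτ, hd⟩ := h'
  refine ⟨ι ⊕ κ, inferInstance, Sum.elim v w, ?_, ?_⟩
  · simp [Fintype.sum_sum_type, hσ, hτ]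
  · simpa [Fintype.sum_sum_type] using add_le_add hc hd

lemma ketBra_mulVec {ι κ : Type*} [Fintype ι] (X : Matrix κ ι ℂ) (v : ι → ℂ) :
    ketBra (X *ᵥ v) = X * ketBra v * Xᴴ := by
  unfold ketBra
  rw [Matrix.mul_vecMulVec, Matrix.vecMulVec_mul, Matrix.star_mulVec]

lemma spinFlip_kronecker_mulVec (U V : Matrix Qubit Qubit ℂ) (v : Qubit × Qubit → ℂ) :
    spinFlip ((U ⊗ₖ V) *ᵥ v) = U.det * V.det * spinFlip v := by
  simp [spinFlip, Matrix.mulVec, dotProduct, Fintype.sum_prod_type, Fin.sum_univ_two,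
    Matrix.det_fin_two]
  ring

lemma norm_det_of_mem_unitaryGroup {n : Type*} [Fintype n] [DecidableEq n] {U : Matrix n n ℂ}
    (hU : U ∈ Matrix.unitaryGroup n ℂ) : ‖U.det‖ = 1 :=
  CStarRing.norm_of_mem_unitary (Matrix.det_of_mem_unitary hU)

lemma HasRoof.conj {σ : Matrix (Qubit × Qubit) (Qubit × Qubit) ℂ} {c : ℝ}
    (h : HasRoof σ c) (s : ℂ) {U V : Matrix Qubit Qubit ℂ} (hU : U ∈ Matrix.unitaryGroup Qubit ℂ)
    (hV : V ∈ Matrix.unitaryGroup Qubit ℂ) :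
    HasRoof ((s • U ⊗ₖ V) * σ * (s • U ⊗ₖ V)ᴴ) (‖s‖ ^ 2 * c) := by
  obtain ⟨ι, _, v, hσ, hc⟩ := h
  refine ⟨ι, inferInstance, fun i => (s • U ⊗ₖ V) *ᵥ v i, ?_, ?_⟩
  · simp only [ketBra_mulVec, hσ, Matrix.mul_sum, Matrix.sum_mul]
  · simp only [Matrix.smul_mulVec, spinFlip_smul, spinFlip_kronecker_mulVec, norm_mul, norm_pow,
      norm_det_of_mem_unitaryGroup hU, norm_det_of_mem_unitaryGroup hV, one_mul]
    rw [← Finset.mul_sum]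
    gcongr

lemma hasRoof_mul_conjTranspose (M : Matrix (Qubit × Qubit) Qubit ℂ) :
    HasRoof (M * Mᴴ) (‖spinFlip (M.col 0)‖ + ‖spinFlip (M.col 1)‖) := by
  refine ⟨Qubit, inferInstance, fun c => M.col c, ?_, ?_⟩
  · ext x y
    simp [Matrix.mul_apply, ketBra, Matrix.vecMulVec_apply, Fin.sum_univ_two]
  · simp [Fin.sum_univ_two]

/-! ### Cuts, marginals and total roofs. -/

/-- Coefficients of `ψ` as a matrix for the cut `AB|C`. -/
def cutAB (ψ : ThreeQubit → ℂ) : Matrix (Qubit × Qubit) Qubit ℂ := fun x c => ψ (x.1, x.2, c)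

/-- Coefficients of `ψ` as a matrix for the cut `AC|B`. -/
def cutAC (ψ : ThreeQubit → ℂ) : Matrix (Qubit × Qubit) Qubit ℂ := fun x b => ψ (x.1, b, x.2)

/-- Coefficients of `ψ` as a matrix for the cut `BC|A`. -/
def cutBC (ψ : ThreeQubit → ℂ) : Matrix (Qubit × Qubit) Qubit ℂ := fun x a => ψ (a, x.1, x.2)

lemma reducedAB_ketBra (ψ : ThreeQubit → ℂ) :
    reducedAB (ketBra ψ) = cutAB ψ * (cutAB ψ)ᴴ := by
  ext x y; simp [reducedAB, cutAB, ketBra, Matrix.vecMulVec_apply, Matrix.mul_apply]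

lemma reducedAC_ketBra (ψ : ThreeQubit → ℂ) :
    reducedAC (ketBra ψ) = cutAC ψ * (cutAC ψ)ᴴ := by
  ext x y; simp [reducedAC, cutAC, ketBra, Matrix.vecMulVec_apply, Matrix.mul_apply]

lemma reducedBC_ketBra (ψ : ThreeQubit → ℂ) :
    reducedBC (ketBra ψ) = cutBC ψ * (cutBC ψ)ᴴ := by
  ext x y; simp [reducedBC, cutBC, ketBra, Matrix.vecMulVec_apply, Matrix.mul_apply]

lemma reducedAB_add (ρ σ : Matrix ThreeQubit ThreeQubit ℂ) :
    reducedAB (ρ + σ) = reducedAB ρ + reducedAB σ := by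
  ext x y; simp [reducedAB, Finset.sum_add_distrib]

lemma reducedAC_add (ρ σ : Matrix ThreeQubit ThreeQubit ℂ) :
    reducedAC (ρ + σ) = reducedAC ρ + reducedAC σ := by
  ext x y; simp [reducedAC, Finset.sum_add_distrib]

lemma reducedBC_add (ρ σ : Matrix ThreeQubit ThreeQubit ℂ) :
    reducedBC (ρ + σ) = reducedBC ρ + reducedBC σ := by
  ext x y; simp [reducedBC, Finset.sum_add_distrib]

lemma trace_reducedAB (ρ : Matrix ThreeQubit ThreeQubit ℂ) : (reducedAB ρ).trace = ρ.trace := by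
  simp [reducedAB, Matrix.trace, Fintype.sum_prod_type, Fin.sum_univ_two]

lemma trace_reducedAC (ρ : Matrix ThreeQubit ThreeQubit ℂ) : (reducedAC ρ).trace = ρ.trace := by
  simp [reducedAC, Matrix.trace, Fintype.sum_prod_type, Fin.sum_univ_two]; ring

lemma trace_reducedBC (ρ : Matrix ThreeQubit ThreeQubit ℂ) : (reducedBC ρ).trace = ρ.trace := by
  simp [reducedBC, Matrix.trace, Fintype.sum_prod_type, Fin.sum_univ_two]; ring

/-- The three two-qubit marginals of `ρ` have roofs of total weight at most `c`. -/
def TotalRoof (ρ : Matrix ThreeQubit ThreeQubit ℂ) (c : ℝ) : Prop :=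
  ∃ c₁ c₂ c₃, HasRoof (reducedAB ρ) c₁ ∧ HasRoof (reducedAC ρ) c₂ ∧ HasRoof (reducedBC ρ) c₃ ∧
    c₁ + c₂ + c₃ ≤ c

lemma TotalRoof.mono {ρ : Matrix ThreeQubit ThreeQubit ℂ} {c d : ℝ} (h : TotalRoof ρ c)
    (hcd : c ≤ d) : TotalRoof ρ d := by
  obtain ⟨c₁, c₂, c₃, h₁, h₂, h₃, h⟩ := h
  exact ⟨c₁, c₂, c₃, h₁, h₂, h₃, h.trans hcd⟩

lemma TotalRoof.add {ρ σ : Matrix ThreeQubit ThreeQubit ℂ} {c d : ℝ} (h : TotalRoof ρ c)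
    (h' : TotalRoof σ d) : TotalRoof (ρ + σ) (c + d) := by
  obtain ⟨c₁, c₂, c₃, h₁, h₂, h₃, h⟩ := h
  obtain ⟨d₁, d₂, d₃, k₁, k₂, k₃, k⟩ := h'
  refine ⟨c₁ + d₁, c₂ + d₂, c₃ + d₃, ?_, ?_, ?_, by linarith⟩
  · rw [reducedAB_add]; exact h₁.add k₁
  · rw [reducedAC_add]; exact h₂.add k₂
  · rw [reducedBC_add]; exact h₃.add k₃

lemma totalRoof_zero : TotalRoof 0 0 := by
  have h : HasRoof 0 0 := ⟨Empty, inferInstance, Empty.elim, by simp, by simp⟩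
  have e₁ : reducedAB 0 = 0 := by ext; simp [reducedAB]
  have e₂ : reducedAC 0 = 0 := by ext; simp [reducedAC]
  have e₃ : reducedBC 0 = 0 := by ext; simp [reducedBC]
  exact ⟨0, 0, 0, e₁ ▸ h, e₂ ▸ h, e₃ ▸ h, by simp⟩

lemma TotalRoof.sum {ι : Type*} (s : Finset ι) {ρ : ι → Matrix ThreeQubit ThreeQubit ℂ} {c : ι → ℝ}
    (h : ∀ i ∈ s, TotalRoof (ρ i) (c i)) : TotalRoof (∑ i ∈ s, ρ i) (∑ i ∈ s, c i) := by
  classical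
  induction s using Finset.induction_on with
  | empty => simpa using totalRoof_zero
  | insert a s ha ih =>
    rw [Finset.sum_insert ha, Finset.sum_insert ha]
    exact (h a (by simp)).add (ih fun i hi => h i (by simp [hi]))

lemma TotalRoof.sumConcurrence_le {ρ : Matrix ThreeQubit ThreeQubit ℂ} {c : ℝ}
    (h : TotalRoof ρ c) (htr : ρ.trace = 1) : sumConcurrence ρ ≤ c := by
  obtain ⟨c₁, c₂, c₃, h₁, h₂, h₃, h⟩ := h
  have k₁ := h₁.concurrence_le (by rw [trace_reducedAB, htr])
  have k₂ := h₂.concurrence_le (by rw [trace_reducedAC, htr])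
  have k₃ := h₃.concurrence_le (by rw [trace_reducedBC, htr])
  unfold sumConcurrence
  linarith

/-! ### Local unitary covariance. -/

/-- The local operator `s · U₁ ⊗ U₂ ⊗ U₃`. -/
def localOp (s : ℂ) (U₁ U₂ U₃ : Matrix Qubit Qubit ℂ) : Matrix ThreeQubit ThreeQubit ℂ :=
  s • U₁ ⊗ₖ (U₂ ⊗ₖ U₃)

lemma localOp_mul (s t : ℂ) (U₁ U₂ U₃ V₁ V₂ V₃ : Matrix Qubit Qubit ℂ) :
    localOp s U₁ U₂ U₃ * localOp t V₁ V₂ V₃ = localOp (s * t) (U₁ * V₁) (U₂ * V₂) (U₃ * V₃) := by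
  simp [localOp, Matrix.mul_kronecker_mul, smul_smul, mul_comm]

lemma localOp_one : localOp 1 1 1 1 = 1 := by
  simp [localOp]

lemma cutAB_localOp (s : ℂ) (U₁ U₂ U₃ : Matrix Qubit Qubit ℂ) (ψ : ThreeQubit → ℂ) :
    cutAB (localOp s U₁ U₂ U₃ *ᵥ ψ) = (s • U₁ ⊗ₖ U₂) * cutAB ψ * U₃ᵀ := by
  ext ⟨a, b⟩ c
  simp [cutAB, localOp, Matrix.mulVec, dotProduct, Matrix.mul_apply, Fintype.sum_prod_type,
    Fin.sum_univ_two]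
  ring

lemma cutAC_localOp (s : ℂ) (U₁ U₂ U₃ : Matrix Qubit Qubit ℂ) (ψ : ThreeQubit → ℂ) :
    cutAC (localOp s U₁ U₂ U₃ *ᵥ ψ) = (s • U₁ ⊗ₖ U₃) * cutAC ψ * U₂ᵀ := by
  ext ⟨a, b⟩ c
  simp [cutAC, localOp, Matrix.mulVec, dotProduct, Matrix.mul_apply, Fintype.sum_prod_type,
    Fin.sum_univ_two]
  ring

lemma cutBC_localOp (s : ℂ) (U₁ U₂ U₃ : Matrix Qubit Qubit ℂ) (ψ : ThreeQubit → ℂ) :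
    cutBC (localOp s U₁ U₂ U₃ *ᵥ ψ) = (s • U₂ ⊗ₖ U₃) * cutBC ψ * U₁ᵀ := by
  ext ⟨a, b⟩ c
  simp [cutBC, localOp, Matrix.mulVec, dotProduct, Matrix.mul_apply, Fintype.sum_prod_type,
    Fin.sum_univ_two]
  ring

lemma transpose_mul_conjTranspose_of_mem_unitaryGroup {n : Type*} [Fintype n] [DecidableEq n]
    {Z : Matrix n n ℂ} (hZ : Z ∈ Matrix.unitaryGroup n ℂ) : Zᵀ * Zᵀᴴ = 1 := by
  have h : Zᴴ * Z = 1 := (Matrix.mem_unitaryGroup_iff' (A := Z)).1 hZ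
  have := congrArg Matrix.transpose h
  rwa [Matrix.transpose_mul, Matrix.transpose_one] at this

/-- A unitary acting on the traced-out party leaves no trace in the marginal. -/
lemma mul_conjTranspose_of_unitary_right {m n : Type*} [Fintype m] [Fintype n] [DecidableEq n]
    (X : Matrix m m ℂ) (M : Matrix m n ℂ) {Z : Matrix n n ℂ} (hZ : Z ∈ Matrix.unitaryGroup n ℂ) :
    (X * M * Zᵀ) * (X * M * Zᵀ)ᴴ = X * (M * Mᴴ) * Xᴴ := by
  calc (X * M * Zᵀ) * (X * M * Zᵀ)ᴴ = X * M * (Zᵀ * Zᵀᴴ) * Mᴴ * Xᴴ := by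
        simp only [Matrix.conjTranspose_mul, Matrix.mul_assoc]
    _ = _ := by
        rw [transpose_mul_conjTranspose_of_mem_unitaryGroup hZ]
        simp only [Matrix.mul_one, Matrix.mul_assoc]

section LocalUnitary

variable {U₁ U₂ U₃ : Matrix Qubit Qubit ℂ}

lemma reducedAB_localOp (s : ℂ) (h₃ : U₃ ∈ Matrix.unitaryGroup Qubit ℂ) (ψ : ThreeQubit → ℂ) :
    reducedAB (ketBra (localOp s U₁ U₂ U₃ *ᵥ ψ)) =
      (s • U₁ ⊗ₖ U₂) * reducedAB (ketBra ψ) * (s • U₁ ⊗ₖ U₂)ᴴ := by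
  rw [reducedAB_ketBra, reducedAB_ketBra, cutAB_localOp, mul_conjTranspose_of_unitary_right _ _ h₃]

lemma reducedAC_localOp (s : ℂ) (h₂ : U₂ ∈ Matrix.unitaryGroup Qubit ℂ) (ψ : ThreeQubit → ℂ) :
    reducedAC (ketBra (localOp s U₁ U₂ U₃ *ᵥ ψ)) =
      (s • U₁ ⊗ₖ U₃) * reducedAC (ketBra ψ) * (s • U₁ ⊗ₖ U₃)ᴴ := by
  rw [reducedAC_ketBra, reducedAC_ketBra, cutAC_localOp, mul_conjTranspose_of_unitary_right _ _ h₂]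

lemma reducedBC_localOp (s : ℂ) (h₁ : U₁ ∈ Matrix.unitaryGroup Qubit ℂ) (ψ : ThreeQubit → ℂ) :
    reducedBC (ketBra (localOp s U₁ U₂ U₃ *ᵥ ψ)) =
      (s • U₂ ⊗ₖ U₃) * reducedBC (ketBra ψ) * (s • U₂ ⊗ₖ U₃)ᴴ := by
  rw [reducedBC_ketBra, reducedBC_ketBra, cutBC_localOp, mul_conjTranspose_of_unitary_right _ _ h₁]

lemma TotalRoof.localOp_pair {ψ φ : ThreeQubit → ℂ} {c : ℝ}
    (h : TotalRoof (ketBra ψ + ketBra φ) c) (s : ℂ)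
    (h₁ : U₁ ∈ Matrix.unitaryGroup Qubit ℂ) (h₂ : U₂ ∈ Matrix.unitaryGroup Qubit ℂ)
    (h₃ : U₃ ∈ Matrix.unitaryGroup Qubit ℂ) :
    TotalRoof (ketBra (localOp s U₁ U₂ U₃ *ᵥ ψ) + ketBra (localOp s U₁ U₂ U₃ *ᵥ φ))
      (‖s‖ ^ 2 * c) := by
  obtain ⟨c₁, c₂, c₃, k₁, k₂, k₃, k⟩ := h
  refine ⟨‖s‖ ^ 2 * c₁, ‖s‖ ^ 2 * c₂, ‖s‖ ^ 2 * c₃, ?_, ?_, ?_, ?_⟩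
  · rw [reducedAB_add, reducedAB_localOp s h₃, reducedAB_localOp s h₃, ← Matrix.add_mul,
      ← Matrix.mul_add, ← reducedAB_add]
    exact k₁.conj s h₁ h₂
  · rw [reducedAC_add, reducedAC_localOp s h₂, reducedAC_localOp s h₂, ← Matrix.add_mul,
      ← Matrix.mul_add, ← reducedAC_add]
    exact k₂.conj s h₁ h₃
  · rw [reducedBC_add, reducedBC_localOp s h₁, reducedBC_localOp s h₁, ← Matrix.add_mul,
      ← Matrix.mul_add, ← reducedBC_add]
    exact k₃.conj s h₂ h₃
  · rw [← mul_add, ← mul_add]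
    gcongr

lemma ketBra_zero {ι : Type*} : ketBra (0 : ι → ℂ) = 0 := by
  simp [ketBra]

lemma TotalRoof.localOp {ψ : ThreeQubit → ℂ} {c : ℝ}
    (h : TotalRoof (ketBra ψ) c) (s : ℂ)
    (h₁ : U₁ ∈ Matrix.unitaryGroup Qubit ℂ) (h₂ : U₂ ∈ Matrix.unitaryGroup Qubit ℂ)
    (h₃ : U₃ ∈ Matrix.unitaryGroup Qubit ℂ) :
    TotalRoof (ketBra (localOp s U₁ U₂ U₃ *ᵥ ψ)) (‖s‖ ^ 2 * c) := by
  have := TotalRoof.localOp_pair (φ := 0) (by simpa [ketBra_zero] using h) s h₁ h₂ h₃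
  simpa [ketBra_zero] using this

lemma dotProduct_localOp (s : ℂ) (h₁ : U₁ ∈ Matrix.unitaryGroup Qubit ℂ)
    (h₂ : U₂ ∈ Matrix.unitaryGroup Qubit ℂ) (h₃ : U₃ ∈ Matrix.unitaryGroup Qubit ℂ)
    (ψ φ : ThreeQubit → ℂ) :
    star (localOp s U₁ U₂ U₃ *ᵥ ψ) ⬝ᵥ (localOp s U₁ U₂ U₃ *ᵥ φ) =
      ((‖s‖ ^ 2 : ℝ) : ℂ) * (star ψ ⬝ᵥ φ) := by
  have hK : U₁ ⊗ₖ (U₂ ⊗ₖ U₃) ∈ Matrix.unitaryGroup ThreeQubit ℂ :=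
    Matrix.kronecker_mem_unitary h₁ (Matrix.kronecker_mem_unitary h₂ h₃)
  have h : (localOp s U₁ U₂ U₃)ᴴ * localOp s U₁ U₂ U₃ = ((‖s‖ ^ 2 : ℝ) : ℂ) • 1 := by
    have h' : (U₁ ⊗ₖ (U₂ ⊗ₖ U₃))ᴴ * (U₁ ⊗ₖ (U₂ ⊗ₖ U₃)) = 1 := Matrix.mem_unitaryGroup_iff'.1 hK
    rw [_root_.localOp, Matrix.conjTranspose_smul, Matrix.smul_mul, Matrix.mul_smul, h', smul_smul]
    rw [Complex.ofReal_pow, ← Complex.mul_conj', mul_comm]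
    rfl
  rw [Matrix.star_mulVec, ← Matrix.dotProduct_mulVec, Matrix.mulVec_mulVec, h]
  simp [Matrix.smul_mulVec]

end LocalUnitary

/-! ### W-type vectors and the canonical form of a pure vector. -/

/-- The unnormalised W vector `|001⟩ + |010⟩ + |100⟩`. -/
def wVec : ThreeQubit → ℂ :=
  fun x => if x = (0, 0, 1) ∨ x = (0, 1, 0) ∨ x = (1, 0, 0) then 1 else 0

/-- `ψ` is a multiple of a vector that is locally unitarily equivalent to the W vector. -/
def IsWType (ψ : ThreeQubit → ℂ) : Prop :=
  ∃ (s : ℂ) (U₁ U₂ U₃ : Matrix Qubit Qubit ℂ), U₁ ∈ Matrix.unitaryGroup Qubit ℂ ∧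
    U₂ ∈ Matrix.unitaryGroup Qubit ℂ ∧ U₃ ∈ Matrix.unitaryGroup Qubit ℂ ∧
      ψ = localOp s U₁ U₂ U₃ *ᵥ wVec

lemma IsWType.localOp {ψ : ThreeQubit → ℂ} (h : IsWType ψ) (s : ℂ) {U₁ U₂ U₃ : Matrix Qubit Qubit ℂ}
    (h₁ : U₁ ∈ Matrix.unitaryGroup Qubit ℂ) (h₂ : U₂ ∈ Matrix.unitaryGroup Qubit ℂ)
    (h₃ : U₃ ∈ Matrix.unitaryGroup Qubit ℂ) : IsWType (localOp s U₁ U₂ U₃ *ᵥ ψ) := by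
  obtain ⟨t, V₁, V₂, V₃, k₁, k₂, k₃, rfl⟩ := h
  exact ⟨s * t, U₁ * V₁, U₂ * V₂, U₃ * V₃, mul_mem h₁ k₁, mul_mem h₂ k₂, mul_mem h₃ k₃, by
    rw [Matrix.mulVec_mulVec, localOp_mul]⟩

lemma localOp_star_mul_localOp {s : ℂ} (hs : s ≠ 0) {U₁ U₂ U₃ : Matrix Qubit Qubit ℂ}
    (h₁ : U₁ ∈ Matrix.unitaryGroup Qubit ℂ) (h₂ : U₂ ∈ Matrix.unitaryGroup Qubit ℂ)
    (h₃ : U₃ ∈ Matrix.unitaryGroup Qubit ℂ) :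
    localOp s⁻¹ (star U₁) (star U₂) (star U₃) * localOp s U₁ U₂ U₃ = 1 := by
  rw [localOp_mul, Matrix.mem_unitaryGroup_iff'.1 h₁, Matrix.mem_unitaryGroup_iff'.1 h₂,
    Matrix.mem_unitaryGroup_iff'.1 h₃, inv_mul_cancel₀ hs, localOp_one]

lemma exists_smul_normalized {x y : ℂ} (h : x ≠ 0 ∨ y ≠ 0) :
    ∃ k : ℂ, ‖k * x‖ ^ 2 + ‖k * y‖ ^ 2 = 1 := by
  have h0 : 0 < ‖x‖ ^ 2 + ‖y‖ ^ 2 := by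
    rcases h with h | h <;> positivity
  refine ⟨((Real.sqrt (‖x‖ ^ 2 + ‖y‖ ^ 2))⁻¹ : ℝ), ?_⟩
  rw [norm_mul, norm_mul, mul_pow, mul_pow, Complex.norm_real, Real.norm_eq_abs, sq_abs, inv_pow,
    Real.sq_sqrt h0.le, ← mul_add, inv_mul_cancel₀ h0.ne']

lemma exists_normalized_isotropic (p q r : ℂ) :
    ∃ x y : ℂ, ‖x‖ ^ 2 + ‖y‖ ^ 2 = 1 ∧ p * x ^ 2 + q * x * y + r * y ^ 2 = 0 := by
  by_cases hp : p = 0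
  · exact ⟨1, 0, by simp, by simp [hp]⟩
  · obtain ⟨d, hd⟩ := IsAlgClosed.exists_pow_nat_eq (q ^ 2 - 4 * p * r) (n := 2) two_pos
    -- The quadratic formula in homogeneous form.
    obtain ⟨k, hk⟩ := exists_smul_normalized (x := -q + d) (y := 2 * p) (Or.inr (by simpa using hp))
    exact ⟨_, _, hk, by linear_combination k ^ 2 * p * hd⟩

lemma exists_normalized_kernel {p q r t : ℂ} (h : p * t - q * r = 0) :
    ∃ x y : ℂ, ‖x‖ ^ 2 + ‖y‖ ^ 2 = 1 ∧ x * p + y * q = 0 ∧ x * r + y * t = 0 := by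
  by_cases h1 : q ≠ 0 ∨ -p ≠ 0
  · obtain ⟨k, hk⟩ := exists_smul_normalized h1
    exact ⟨_, _, hk, by ring, by linear_combination -k * h⟩
  by_cases h2 : t ≠ 0 ∨ -r ≠ 0
  · obtain ⟨k, hk⟩ := exists_smul_normalized h2
    exact ⟨_, _, hk, by linear_combination k * h, by ring⟩
  · simp only [not_or, not_not, neg_eq_zero] at h1 h2
    exact ⟨1, 0, by simp, by simp [h1], by simp [h2]⟩

/-- A unitary matrix with second row `(x, y)`. -/
def unitaryOfRow (x y : ℂ) : Matrix Qubit Qubit ℂ := !![star y, -star x; x, y]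

lemma unitaryOfRow_mem {x y : ℂ} (h : ‖x‖ ^ 2 + ‖y‖ ^ 2 = 1) :
    unitaryOfRow x y ∈ Matrix.unitaryGroup Qubit ℂ := by
  have h' : x * star x + y * star y = 1 := by
    simp only [Complex.star_def, Complex.mul_conj']
    exact_mod_cast h
  rw [Matrix.mem_unitaryGroup_iff]
  ext i j
  fin_cases i <;> fin_cases j <;>
    simp [unitaryOfRow, Matrix.mul_apply, Fin.sum_univ_two, Matrix.star_apply] at h' ⊢ <;>
    first
      | linear_combination h'
      | ring

lemma localOp_mulVec_apply (U₁ U₂ U₃ : Matrix Qubit Qubit ℂ) (ψ : ThreeQubit → ℂ) (a b c : Qubit) :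
    (localOp 1 U₁ U₂ U₃ *ᵥ ψ) (a, b, c) =
      ∑ a', U₁ a a' * ∑ b', U₂ b b' * ∑ c', U₃ c c' * ψ (a', b', c') := by
  simp [localOp, Matrix.mulVec, dotProduct, Fintype.sum_prod_type, Fin.sum_univ_two]
  ring

/-- Every three-qubit vector can be rotated locally so that its `|··1⟩` part is a multiple of
`|001⟩`. -/
lemma exists_local_canonical (ψ : ThreeQubit → ℂ) :
    ∃ U₁ ∈ Matrix.unitaryGroup Qubit ℂ, ∃ U₂ ∈ Matrix.unitaryGroup Qubit ℂ,
      ∃ U₃ ∈ Matrix.unitaryGroup Qubit ℂ, ∀ χ, χ = localOp 1 U₁ U₂ U₃ *ᵥ ψ →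
        χ (0, 1, 1) = 0 ∧ χ (1, 0, 1) = 0 ∧ χ (1, 1, 1) = 0 := by
  -- The quadratic form is the determinant of xψ(·,·,0) + yψ(·,·,1), so the new slice `m` at C = 1
  -- is singular. Its left kernel (u, v) and right kernel (w, z) become the second rows of U₁ and
  -- U₂.
  obtain ⟨x, y, hxy, h0⟩ := exists_normalized_isotropic
    (ψ (0, 0, 0) * ψ (1, 1, 0) - ψ (0, 1, 0) * ψ (1, 0, 0))
    (ψ (0, 0, 0) * ψ (1, 1, 1) + ψ (0, 0, 1) * ψ (1, 1, 0) - ψ (0, 1, 0) * ψ (1, 0, 1)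
      - ψ (0, 1, 1) * ψ (1, 0, 0))
    (ψ (0, 0, 1) * ψ (1, 1, 1) - ψ (0, 1, 1) * ψ (1, 0, 1))
  set m : Qubit → Qubit → ℂ := fun a b => x * ψ (a, b, 0) + y * ψ (a, b, 1) with hm
  obtain ⟨u, v, huv, k1, k2⟩ := exists_normalized_kernel
    (p := m 0 0) (q := m 1 0) (r := m 0 1) (t := m 1 1) (by simp only [hm]; linear_combination h0)
  obtain ⟨w, z, hwz, l1, l2⟩ := exists_normalized_kernel
    (p := m 0 0) (q := m 0 1) (r := m 1 0) (t := m 1 1) (by simp only [hm]; linear_combination h0)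
  refine ⟨_, unitaryOfRow_mem huv, _, unitaryOfRow_mem hwz, _, unitaryOfRow_mem hxy, ?_⟩
  rintro χ rfl
  simp only [localOp_mulVec_apply, Fin.sum_univ_two, unitaryOfRow, Matrix.of_apply,
    Matrix.cons_val_zero, Matrix.cons_val_one, Matrix.cons_val', Matrix.cons_val_fin_one]
  simp only [hm] at k1 k2 l1 l2
  refine ⟨?_, ?_, ?_⟩
  · linear_combination star v * l1 - star u * l2
  · linear_combination star z * k1 - star w * k2
  · linear_combination w * k1 + z * k2

lemma totalRoof_cuts (ψ : ThreeQubit → ℂ) : TotalRoof (ketBra ψ)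
    ((‖spinFlip ((cutAB ψ).col 0)‖ + ‖spinFlip ((cutAB ψ).col 1)‖) +
      (‖spinFlip ((cutAC ψ).col 0)‖ + ‖spinFlip ((cutAC ψ).col 1)‖) +
      (‖spinFlip ((cutBC ψ).col 0)‖ + ‖spinFlip ((cutBC ψ).col 1)‖)) := by
  refine ⟨_, _, _, ?_, ?_, ?_, le_rfl⟩
  · rw [reducedAB_ketBra]; exact hasRoof_mul_conjTranspose _
  · rw [reducedAC_ketBra]; exact hasRoof_mul_conjTranspose _
  · rw [reducedBC_ketBra]; exact hasRoof_mul_conjTranspose _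

lemma sum_threeQubit {M : Type*} [AddCommMonoid M] (f : ThreeQubit → M) :
    ∑ x, f x = f (0, 0, 0) + f (0, 0, 1) + (f (0, 1, 0) + f (0, 1, 1)) +
      (f (1, 0, 0) + f (1, 0, 1) + (f (1, 1, 0) + f (1, 1, 1))) := by
  simp [Fintype.sum_prod_type, Fin.sum_univ_two]

lemma diagonal_mem_unitaryGroup {d : Qubit → ℂ} (h : ∀ i, ‖d i‖ = 1) :
    Matrix.diagonal d ∈ Matrix.unitaryGroup Qubit ℂ := by
  rw [Matrix.mem_unitaryGroup_iff, Matrix.star_eq_conjTranspose, Matrix.diagonal_conjTranspose,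
    Matrix.diagonal_mul_diagonal, ← Matrix.diagonal_one]
  congr 1
  funext i
  simp [Complex.mul_conj', h i]

lemma isWType_of_norm_eq {ψ : ThreeQubit → ℂ} (h000 : ψ (0, 0, 0) = 0) (h110 : ψ (1, 1, 0) = 0)
    (h011 : ψ (0, 1, 1) = 0) (h101 : ψ (1, 0, 1) = 0) (h111 : ψ (1, 1, 1) = 0)
    (h1 : ‖ψ (0, 1, 0)‖ = ‖ψ (0, 0, 1)‖) (h2 : ‖ψ (1, 0, 0)‖ = ‖ψ (0, 0, 1)‖) : IsWType ψ := by
  by_cases h0 : ψ (0, 0, 1) = 0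
  · have h1' : ψ (0, 1, 0) = 0 := by simpa [h0] using h1
    have h2' : ψ (1, 0, 0) = 0 := by simpa [h0] using h2
    refine ⟨0, 1, 1, 1, one_mem _, one_mem _, one_mem _, ?_⟩
    funext ⟨a, b, c⟩
    fin_cases a <;> fin_cases b <;> fin_cases c <;>
      simp [localOp, h000, h110, h011, h101, h111, h0, h1', h2']
  · have hn : ‖ψ (0, 0, 1)‖ ≠ 0 := by simpa using h0
    -- The amplitude at 001 is the global factor; diagonal unitaries on A and B absorb the two
    -- relative phases.
    refine ⟨ψ (0, 0, 1), Matrix.diagonal ![1, ψ (1, 0, 0) / ψ (0, 0, 1)],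
      Matrix.diagonal ![1, ψ (0, 1, 0) / ψ (0, 0, 1)], 1, diagonal_mem_unitaryGroup ?_,
      diagonal_mem_unitaryGroup ?_, one_mem _, ?_⟩
    · intro i; fin_cases i <;> simp [h2, hn]
    · intro i; fin_cases i <;> simp [h1, hn]
    · funext ⟨a, b, c⟩
      fin_cases a <;> fin_cases b <;> fin_cases c <;>
      simp [localOp, Matrix.mulVec, dotProduct, Fintype.sum_prod_type,
        Fin.sum_univ_two, wVec, Matrix.one_apply,
        h000, h110, h011, h101, h111] <;> field_simp

/-- Uses xy + yz + zx ≤ x² + y² + z² for the moduli of the three W amplitudes, and 2xy ≤ x² + y² for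
those at 000 and 110. The latter is off by a factor of two from what the bound allows, which is why
equality kills these two amplitudes. -/
lemma exists_totalRoof_of_canonical {χ : ThreeQubit → ℂ} (h011 : χ (0, 1, 1) = 0)
    (h101 : χ (1, 0, 1) = 0) (h111 : χ (1, 1, 1) = 0) :
    ∃ c ≤ 2 * ∑ x, ‖χ x‖ ^ 2, TotalRoof (ketBra χ) c ∧ (c = 2 * ∑ x, ‖χ x‖ ^ 2 → IsWType χ) := by
  have hab : ‖χ (0, 0, 0) * χ (1, 1, 0) - χ (0, 1, 0) * χ (1, 0, 0)‖ ≤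
      ‖χ (0, 0, 0)‖ * ‖χ (1, 1, 0)‖ + ‖χ (0, 1, 0)‖ * ‖χ (1, 0, 0)‖ := by
    simpa using norm_sub_le (χ (0, 0, 0) * χ (1, 1, 0)) (χ (0, 1, 0) * χ (1, 0, 0))
  have key := totalRoof_cuts χ
  simp only [spinFlip, cutAB, cutAC, cutBC, Matrix.col_apply, h011, h101, h111, mul_zero, zero_mul,
    sub_zero, zero_sub, norm_neg, norm_zero, add_zero, norm_mul, Complex.norm_ofNat] at key
  refine ⟨_, ?_, key, ?_⟩ <;> rw [sum_threeQubit] <;>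
    simp only [h011, h101, h111, norm_zero]
  · nlinarith [sq_nonneg (‖χ (0, 0, 1)‖ - ‖χ (0, 1, 0)‖), sq_nonneg (‖χ (0, 0, 1)‖ - ‖χ (1, 0, 0)‖),
      sq_nonneg (‖χ (0, 1, 0)‖ - ‖χ (1, 0, 0)‖), sq_nonneg (‖χ (0, 0, 0)‖ - ‖χ (1, 1, 0)‖),
      sq_nonneg ‖χ (0, 0, 0)‖, sq_nonneg ‖χ (1, 1, 0)‖]
  · intro h
    have e1 := sq_nonneg (‖χ (0, 0, 1)‖ - ‖χ (0, 1, 0)‖)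
    have e2 := sq_nonneg (‖χ (0, 0, 1)‖ - ‖χ (1, 0, 0)‖)
    have e3 := sq_nonneg (‖χ (0, 1, 0)‖ - ‖χ (1, 0, 0)‖)
    have e4 := sq_nonneg (‖χ (0, 0, 0)‖ - ‖χ (1, 1, 0)‖)
    have e5 := sq_nonneg ‖χ (0, 0, 0)‖
    have e6 := sq_nonneg ‖χ (1, 1, 0)‖
    have d1 : (‖χ (0, 0, 1)‖ - ‖χ (0, 1, 0)‖) ^ 2 = 0 := by nlinarith
    have d2 : (‖χ (0, 0, 1)‖ - ‖χ (1, 0, 0)‖) ^ 2 = 0 := by nlinarith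
    have d5 : ‖χ (0, 0, 0)‖ ^ 2 = 0 := by nlinarith
    have d6 : ‖χ (1, 1, 0)‖ ^ 2 = 0 := by nlinarith
    simp only [ne_eq, OfNat.ofNat_ne_zero, not_false_eq_true, pow_eq_zero_iff, norm_eq_zero,
      sub_eq_zero] at d1 d2 d5 d6
    exact isWType_of_norm_eq d5 d6 h011 h101 h111 d1.symm d2.symm

lemma sum_norm_sq_eq_dotProduct {ι : Type*} [Fintype ι] (ψ : ι → ℂ) :
    ((∑ x, ‖ψ x‖ ^ 2 : ℝ) : ℂ) = star ψ ⬝ᵥ ψ := by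
  simp [dotProduct, Complex.conj_mul']

lemma sum_norm_sq_localOp (s : ℂ) {U₁ U₂ U₃ : Matrix Qubit Qubit ℂ}
    (h₁ : U₁ ∈ Matrix.unitaryGroup Qubit ℂ)
    (h₂ : U₂ ∈ Matrix.unitaryGroup Qubit ℂ) (h₃ : U₃ ∈ Matrix.unitaryGroup Qubit ℂ)
    (ψ : ThreeQubit → ℂ) :
    ∑ x, ‖(localOp s U₁ U₂ U₃ *ᵥ ψ) x‖ ^ 2 = ‖s‖ ^ 2 * ∑ x, ‖ψ x‖ ^ 2 := by
  have := dotProduct_localOp s h₁ h₂ h₃ ψ ψ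
  rw [← sum_norm_sq_eq_dotProduct, ← sum_norm_sq_eq_dotProduct] at this
  exact_mod_cast this

lemma exists_totalRoof_ketBra (ψ : ThreeQubit → ℂ) :
    ∃ c ≤ 2 * ∑ x, ‖ψ x‖ ^ 2, TotalRoof (ketBra ψ) c ∧ (c = 2 * ∑ x, ‖ψ x‖ ^ 2 → IsWType ψ) := by
  obtain ⟨U₁, h₁, U₂, h₂, U₃, h₃, h⟩ := exists_local_canonical ψ
  obtain ⟨k₁, k₂, k₃⟩ := h _ rfl
  obtain ⟨c, hc, hr, hw⟩ := exists_totalRoof_of_canonical k₁ k₂ k₃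
  rw [sum_norm_sq_localOp 1 h₁ h₂ h₃, norm_one, one_pow, one_mul] at hc hw
  have hinv := localOp_star_mul_localOp one_ne_zero h₁ h₂ h₃
  rw [inv_one] at hinv
  have hψ : ψ = localOp 1 (star U₁) (star U₂) (star U₃) *ᵥ (localOp 1 U₁ U₂ U₃ *ᵥ ψ) := by
    rw [Matrix.mulVec_mulVec, hinv, Matrix.one_mulVec]
  have s₁ := Unitary.star_mem h₁
  have s₂ := Unitary.star_mem h₂
  have s₃ := Unitary.star_mem h₃
  refine ⟨c, hc, ?_, fun hcc => ?_⟩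
  · have := hr.localOp 1 s₁ s₂ s₃
    rwa [← hψ, norm_one, one_pow, one_mul] at this
  · rw [hψ]
    exact (hw hcc).localOp 1 s₁ s₂ s₃

/-! ### Polynomial invariants of W-type vectors. -/

/-- The symmetric bilinear form polarising `spinFlip`. -/
def flipForm (v w : Qubit × Qubit → ℂ) : ℂ :=
  v (0, 0) * w (1, 1) + v (1, 1) * w (0, 0) - v (0, 1) * w (1, 0) - v (1, 0) * w (0, 1)

/-- The coefficient matrix of the W vector for each of the three cuts. -/
def wCut : Matrix (Qubit × Qubit) Qubit ℂ := cutAB wVec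

lemma cutAC_wVec : cutAC wVec = wCut := by
  ext ⟨a, b⟩ c
  fin_cases a <;> fin_cases b <;> fin_cases c <;> simp [wCut, cutAC, cutAB, wVec]

lemma cutBC_wVec : cutBC wVec = wCut := by
  ext ⟨a, b⟩ c
  fin_cases a <;> fin_cases b <;> fin_cases c <;> simp [wCut, cutBC, cutAB, wVec]

/-- For W itself the Gram matrix of the columns is −2 e₀e₀ᵀ; a local operator turns it into a
multiple of zzᵀ, with z the first column of `Z`. Rank one (vanishing three-tangle) and fixed
Frobenius norm are the two identities in `WInvariants`. -/
lemma flipForm_wCut_image (s : ℂ) (U V Z : Matrix Qubit Qubit ℂ) (i j : Qubit) :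
    flipForm (((s • U ⊗ₖ V) * wCut * Zᵀ).col i) (((s • U ⊗ₖ V) * wCut * Zᵀ).col j) =
      -2 * s ^ 2 * U.det * V.det * (Z i 0 * Z j 0) := by
  simp [flipForm, Matrix.mul_apply, Matrix.col_apply, Fintype.sum_prod_type, Fin.sum_univ_two,
    Matrix.det_fin_two, wCut, cutAB, wVec]
  ring

lemma normSq_column_of_mem_unitaryGroup {Z : Matrix Qubit Qubit ℂ}
    (hZ : Z ∈ Matrix.unitaryGroup Qubit ℂ) :
    Complex.normSq (Z 0 0) + Complex.normSq (Z 1 0) = 1 := by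
  have h := congrFun (congrFun (Matrix.mem_unitaryGroup_iff'.1 hZ) 0) 0
  simp only [Matrix.mul_apply, Fin.sum_univ_two, Matrix.star_apply, Matrix.one_apply_eq,
    Complex.star_def, ← Complex.normSq_eq_conj_mul_self] at h
  exact_mod_cast h

/-- The invariants of a W-type vector of squared norm `N` across a cut with coefficient
matrix `M`. -/
def WInvariants (M : Matrix (Qubit × Qubit) Qubit ℂ) (N : ℝ) : Prop :=
  flipForm (M.col 0) (M.col 1) ^ 2 = flipForm (M.col 0) (M.col 0) * flipForm (M.col 1) (M.col 1) ∧
  9 * (Complex.normSq (flipForm (M.col 0) (M.col 0)) +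
    2 * Complex.normSq (flipForm (M.col 0) (M.col 1)) +
    Complex.normSq (flipForm (M.col 1) (M.col 1))) = 4 * N ^ 2

lemma wInvariants_image (s : ℂ) {U V Z : Matrix Qubit Qubit ℂ}
    (hU : U ∈ Matrix.unitaryGroup Qubit ℂ) (hV : V ∈ Matrix.unitaryGroup Qubit ℂ)
    (hZ : Z ∈ Matrix.unitaryGroup Qubit ℂ) :
    WInvariants ((s • U ⊗ₖ V) * wCut * Zᵀ) (‖s‖ ^ 2 * 3) := by
  have h := normSq_column_of_mem_unitaryGroup hZ
  have hd : ∀ {X : Matrix Qubit Qubit ℂ}, X ∈ Matrix.unitaryGroup Qubit ℂ →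
      Complex.normSq X.det = 1 := fun hX => by
    rw [Complex.normSq_eq_norm_sq, norm_det_of_mem_unitaryGroup hX, one_pow]
  have h2 : Complex.normSq (-2) = 4 := by simp [Complex.normSq_apply]; norm_num
  unfold WInvariants
  simp only [flipForm_wCut_image]
  refine ⟨by ring, ?_⟩
  simp only [map_mul, map_pow, hd hU, hd hV, h2, ← Complex.normSq_eq_norm_sq]
  linear_combination 36 * Complex.normSq s ^ 2 *
    (Complex.normSq (Z 0 0) + Complex.normSq (Z 1 0) + 1) * h

lemma sum_norm_sq_wVec : ∑ x, ‖wVec x‖ ^ 2 = 3 := by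
  rw [sum_threeQubit]; simp [wVec]; norm_num

lemma IsWType.wInvariants {ψ : ThreeQubit → ℂ} (h : IsWType ψ) :
    WInvariants (cutAB ψ) (∑ x, ‖ψ x‖ ^ 2) ∧ WInvariants (cutAC ψ) (∑ x, ‖ψ x‖ ^ 2) ∧
      WInvariants (cutBC ψ) (∑ x, ‖ψ x‖ ^ 2) := by
  obtain ⟨s, U₁, U₂, U₃, h₁, h₂, h₃, rfl⟩ := h
  rw [sum_norm_sq_localOp s h₁ h₂ h₃, sum_norm_sq_wVec, cutAB_localOp, cutAC_localOp,
    cutBC_localOp, cutAC_wVec, cutBC_wVec]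
  exact ⟨wInvariants_image s h₁ h₂ h₃, wInvariants_image s h₁ h₃ h₂, wInvariants_image s h₂ h₃ h₁⟩

/-! ### Planes consisting of W-type vectors. -/

/-- First-order constraints on a direction along which the W invariants persist. -/
lemma WInvariants.first_order {F : Matrix (Qubit × Qubit) Qubit ℂ}
    (h : ∀ t : ℂ, WInvariants (wCut + t • F) (3 + 3 * Complex.normSq t)) :
    F (1, 1) 1 = 0 ∧ F (0, 1) 0 + F (1, 0) 0 = 0 := by
  simp only [WInvariants, flipForm, wCut, cutAB, wVec, Matrix.col_apply, Matrix.add_apply,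
    Matrix.smul_apply, smul_eq_mul, Prod.mk.injEq, Fin.isValue, one_ne_zero, zero_ne_one,
    and_true, and_false, or_false, or_true, and_self,
    if_true, if_false, zero_add] at h
  have hd : F (1, 1) 1 = 0 := by
    -- Both identities are of degree at most 4 in t. The combination 8(e(1) − e(−1)) − (e(2) −
    -- e(−2)) removes the even and cubic terms and leaves 12 times the linear coefficient.
    have e1 := (h 1).1
    have e2 := (h (-1)).1
    have e3 := (h 2).1
    have e4 := (h (-2)).1
    linear_combination (1 / 48 : ℂ) * (8 * (e1 - e2) - (e3 - e4))
  refine ⟨hd, ?_⟩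
  simp only [hd] at h
  have e1 := (h 1).2
  have e2 := (h (-1)).2
  have e3 := (h 2).2
  have e4 := (h (-2)).2
  -- Real t yields the real part of the linear coefficient, imaginary t its imaginary part.
  have f1 := (h Complex.I).2
  have f2 := (h (-Complex.I)).2
  have f3 := (h (2 * Complex.I)).2
  have f4 := (h (-2 * Complex.I)).2
  simp only [Complex.normSq_apply, Complex.add_re, Complex.add_im, Complex.sub_re, Complex.sub_im,
    Complex.mul_re, Complex.mul_im, Complex.one_re, Complex.one_im, Complex.neg_re, Complex.neg_im,
    Complex.I_re, Complex.I_im, Complex.re_ofNat, Complex.im_ofNat, Complex.zero_re,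
    Complex.zero_im] at e1 e2 e3 e4 f1 f2 f3 f4
  apply Complex.ext
  · simp only [Complex.add_re, Complex.zero_re]
    linear_combination (1 / (12 * 2 * 9 * 4) : ℝ) * (8 * (e1 - e2) - (e3 - e4))
  · simp only [Complex.add_im, Complex.zero_im]
    linear_combination (-1 / (12 * 2 * 9 * 4) : ℝ) * (8 * (f1 - f2) - (f3 - f4))

/-- Second-order constraints on a direction along which the W invariants persist. -/
lemma WInvariants.second_order {F : Matrix (Qubit × Qubit) Qubit ℂ}
    (h : ∀ t : ℂ, WInvariants (wCut + t • F) (3 + 3 * Complex.normSq t))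
    (h010 : F (0, 1) 0 = 0) (h100 : F (1, 0) 0 = 0) (h001 : F (0, 0) 1 = 0)
    (h111 : F (1, 1) 1 = 0) :
    F (0, 0) 0 * F (1, 1) 0 = 0 ∧ Complex.normSq (F (0, 1) 1 * F (1, 0) 1) = 1 ∧
      (F (1, 1) 0 - F (0, 1) 1 - F (1, 0) 1) ^ 2 = 4 * (F (0, 1) 1 * F (1, 0) 1) := by
  simp only [WInvariants, flipForm, wCut, cutAB, wVec, Matrix.col_apply, Matrix.add_apply,
    Matrix.smul_apply, smul_eq_mul, Prod.mk.injEq, Fin.isValue, one_ne_zero, zero_ne_one,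
    and_true, and_false, or_false, or_true, and_self,
    if_true, if_false, zero_add, h010, h100, h001, h111, mul_zero, add_zero, mul_one,
    zero_sub, one_mul] at h
  generalize F (0, 0) 0 = A at *
  generalize F (1, 1) 0 = p at *
  generalize F (0, 1) 1 = q at *
  generalize F (1, 0) 1 = r at *
  have hA : A * p = 0 := by
    -- Only Re(t²Ap) depends on the phase of t: comparing 1 with i isolates the real part of Ap,
    -- comparing 1 + i with 1 − i the imaginary part.
    have e1 := (h 1).2
    have e2 := (h Complex.I).2
    have e3 := (h (1 + Complex.I)).2
    have e4 := (h (1 - Complex.I)).2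
    simp only [Complex.normSq_apply, Complex.add_re, Complex.add_im, Complex.sub_re, Complex.sub_im,
      Complex.mul_re, Complex.mul_im, Complex.one_re, Complex.one_im, Complex.neg_re,
      Complex.neg_im, Complex.I_re, Complex.I_im] at e1 e2 e3 e4
    apply Complex.ext
    · simp only [Complex.mul_re, Complex.zero_re]
      linear_combination (-1 / 144 : ℝ) * (e1 - e2)
    · simp only [Complex.mul_im, Complex.zero_im]
      linear_combination (1 / 288 : ℝ) * (e3 - e4)
  refine ⟨hA, ?_, ?_⟩
  -- With Ap = 0 the norm identity is a polynomial in |t|²; e(2) − 4e(1) cancels the |t|² term and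
  -- leaves |qr|² from |t|⁴.
  · have e1 := (h 1).2
    have e2 := (h 2).2
    have e0 := congrArg Complex.re hA
    have e0' := congrArg Complex.im hA
    simp only [Complex.normSq_apply, Complex.add_re, Complex.add_im, Complex.sub_re, Complex.sub_im,
      Complex.mul_re, Complex.mul_im, Complex.one_re, Complex.one_im, Complex.neg_re,
      Complex.neg_im, Complex.re_ofNat, Complex.im_ofNat, Complex.zero_re, Complex.zero_im]
      at e1 e2 e0 e0' ⊢
    linear_combination (1 / 432 : ℝ) * (e2 - 4 * e1) - (A.re * p.re - A.im * p.im) * e0 -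
      (A.re * p.im + A.im * p.re) * e0'
  · linear_combination (h 1).1 - 4 * q * r * hA

/-- Unitary freedom in decompositions: (s, t) and (−t̄, s̄) are the rows of a unitary matrix. -/
lemma ketBra_add_ketBra_rotate {ι : Type*} {s t : ℂ} (h : ‖s‖ ^ 2 + ‖t‖ ^ 2 = 1) (x y : ι → ℂ) :
    ketBra (s • x + t • y) + ketBra (-star t • x + star s • y) = ketBra x + ketBra y := by
  have h' : s * star s + t * star t = 1 := by
    simp only [Complex.star_def, Complex.mul_conj']
    exact_mod_cast h
  ext i j
  simp only [ketBra, Matrix.add_apply, Matrix.vecMulVec_apply, Pi.add_apply, Pi.smul_apply,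
    Pi.star_apply, smul_eq_mul, star_add, star_mul', star_neg, star_star]
  linear_combination (x i * star (x j) + y i * star (y j)) * h'

/-- Parallelogram law. -/
lemma norm_add_lt_two {b c : ℂ} (hb : Complex.normSq b = 1) (hc : Complex.normSq c = 1)
    (hbc : b ≠ c) : ‖b + c‖ < 2 := by
  have h : 0 < Complex.normSq (b - c) := Complex.normSq_pos.2 (sub_ne_zero.2 hbc)
  have h2 : ‖b + c‖ ^ 2 + Complex.normSq (b - c) = 4 := by
    rw [Complex.sq_norm]
    simp only [Complex.normSq_apply, Complex.add_re, Complex.add_im, Complex.sub_re,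
      Complex.sub_im] at *
    linear_combination 2 * hb + 2 * hc
  nlinarith [norm_nonneg (b + c)]

/-- The columns |01⟩ + |10⟩ of W and b|01⟩ + c|10⟩ of f are mixed with equal weights and a
well-chosen phase; the two remaining columns are product vectors. Without mixing the weight would be
4. -/
lemma hasRoof_reducedAB_pair {f : ThreeQubit → ℂ} (h000 : f (0, 0, 0) = 0)
    (h010 : f (0, 1, 0) = 0) (h001 : f (0, 0, 1) = 0)
    (h111 : f (1, 1, 1) = 0) (hb : Complex.normSq (f (0, 1, 1)) = 1)
    (hc : Complex.normSq (f (1, 0, 1)) = 1) :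
    HasRoof (reducedAB (ketBra wVec + ketBra f)) (2 * ‖f (0, 1, 1) + f (1, 0, 1)‖) := by
  set b := f (0, 1, 1) with hbdef
  set c := f (1, 0, 1) with hcdef
  -- With v² = −bc the terms 1 and v̄²bc cancel in (1 + v̄b)(1 + v̄c), leaving only the multiple of
  -- b + c.
  obtain ⟨v, hv⟩ := IsAlgClosed.exists_pow_nat_eq (-(b * c)) (n := 2) two_pos
  have hvn : ‖v‖ = 1 := by
    have := congrArg Complex.normSq hv
    rw [map_pow, Complex.normSq_neg, map_mul, hb, hc, mul_one, Complex.normSq_eq_norm_sq,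
      ← pow_mul] at this
    exact (pow_eq_one_iff_of_nonneg (norm_nonneg v) (by norm_num)).1 this
  have hvv : star v * v = 1 := by
    rw [Complex.star_def, Complex.conj_mul', hvn]; simp
  set r : ℂ := (((Real.sqrt 2)⁻¹ : ℝ) : ℂ) with hr
  have hr2 : r ^ 2 = 1 / 2 := by
    rw [hr, ← Complex.ofReal_pow, inv_pow, Real.sq_sqrt (by norm_num)]; norm_num
  have hrs : star r = r := by rw [hr, Complex.star_def, Complex.conj_ofReal]
  have hrn : ‖r‖ ^ 2 = 1 / 2 := by rw [← norm_pow, hr2]; norm_num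
  have hrot := ketBra_add_ketBra_rotate (s := r) (t := r * star v)
    (by rw [norm_mul, norm_star, hvn, mul_one, hrn]; norm_num) (wCut.col 0) ((cutAB f).col 1)
  refine ⟨Fin 4, inferInstance, ![r • wCut.col 0 + (r * star v) • (cutAB f).col 1,
    -star (r * star v) • wCut.col 0 + star r • (cutAB f).col 1, wCut.col 1, (cutAB f).col 0],
    ?_, ?_⟩
  · simp only [Fin.sum_univ_four, Matrix.cons_val]
    rw [hrot, reducedAB_add, reducedAB_ketBra, reducedAB_ketBra]
    ext x y
    simp [Matrix.mul_apply, Fin.sum_univ_two, ketBra, Matrix.vecMulVec_apply, wCut]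
    ring
  · have e1 : spinFlip (r • wCut.col 0 + (r * star v) • (cutAB f).col 1) = -(star v * (b + c)) := by
      simp only [spinFlip, wCut, cutAB, wVec, Matrix.col_apply, Pi.add_apply, Pi.smul_apply,
        smul_eq_mul, h001, h111, ← hbdef, ← hcdef]
      simp only [Prod.mk.injEq, Fin.isValue, one_ne_zero, zero_ne_one,
        and_true, and_false, or_false, or_true, and_self,
        if_true, if_false, mul_zero, add_zero, mul_one]
      linear_combination (-2 * (1 + star v * b) * (1 + star v * c)) * hr2 - star v ^ 2 * hv +
        (star v * v + 1) * hvv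
    have e2 : spinFlip (-star (r * star v) • wCut.col 0 + star r • (cutAB f).col 1) =
        v * (b + c) := by
      simp only [spinFlip, wCut, cutAB, wVec, Matrix.col_apply, Pi.add_apply, Pi.smul_apply,
        smul_eq_mul, h001, h111, ← hbdef, ← hcdef, star_mul', star_star, hrs]
      simp only [Prod.mk.injEq, Fin.isValue, one_ne_zero, zero_ne_one,
        and_true, and_false, or_false, or_true, and_self,
        if_true, if_false, mul_zero, add_zero, mul_one]
      linear_combination (-2 * (b - v) * (c - v)) * hr2 - hv
    have e3 : spinFlip (wCut.col 1) = 0 := by simp [spinFlip, wCut, cutAB, wVec]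
    have e4 : spinFlip ((cutAB f).col 0) = 0 := by simp [spinFlip, cutAB, h000, h010]
    simp only [Fin.sum_univ_four, Matrix.cons_val, e1, e2, e3, e4, norm_neg, norm_mul, norm_star,
      hvn, norm_zero]
    linarith

lemma sum_norm_sq_smul_add_smul {ι : Type*} [Fintype ι] {ψ φ : ι → ℂ} (h : star ψ ⬝ᵥ φ = 0)
    (s t : ℂ) : ∑ x, ‖(s • ψ + t • φ) x‖ ^ 2 =
      ‖s‖ ^ 2 * ∑ x, ‖ψ x‖ ^ 2 + ‖t‖ ^ 2 * ∑ x, ‖φ x‖ ^ 2 := by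
  have h' : star φ ⬝ᵥ ψ = 0 := by
    have := congrArg star h
    rwa [Matrix.star_dotProduct, star_star, star_zero] at this
  have key : ((∑ x, ‖(s • ψ + t • φ) x‖ ^ 2 : ℝ) : ℂ) =
      ((‖s‖ ^ 2 * ∑ x, ‖ψ x‖ ^ 2 + ‖t‖ ^ 2 * ∑ x, ‖φ x‖ ^ 2 : ℝ) : ℂ) := by
    rw [Complex.ofReal_add, Complex.ofReal_mul, Complex.ofReal_mul, sum_norm_sq_eq_dotProduct,
      sum_norm_sq_eq_dotProduct, sum_norm_sq_eq_dotProduct, Complex.ofReal_pow, Complex.ofReal_pow,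
      ← Complex.mul_conj', ← Complex.mul_conj']
    simp only [star_add, star_smul, add_dotProduct, dotProduct_add, smul_dotProduct,
      dotProduct_smul, h, h', smul_eq_mul, Complex.star_def]
    ring
  exact_mod_cast key

lemma IsWType.smul {ψ : ThreeQubit → ℂ} (h : IsWType ψ) (k : ℂ) : IsWType (k • ψ) := by
  have := h.localOp k (one_mem _) (one_mem _) (one_mem _)
  simpa [_root_.localOp, Matrix.smul_mulVec] using this

lemma exists_lt_totalRoof_wVec_add {f : ThreeQubit → ℂ} (hW : ∀ t : ℂ, IsWType (wVec + t • f))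
    (horth : star wVec ⬝ᵥ f = 0) (hf : ∑ x, ‖f x‖ ^ 2 = 3) :
    ∃ c < 12, TotalRoof (ketBra wVec + ketBra f) c := by
  have hN : ∀ t : ℂ, ∑ x, ‖(wVec + t • f) x‖ ^ 2 = 3 + 3 * Complex.normSq t := by
    intro t
    have := sum_norm_sq_smul_add_smul horth 1 t
    rw [one_smul, sum_norm_sq_wVec, hf, norm_one, ← Complex.normSq_eq_norm_sq] at this
    rw [this]; ring
  have hAB : ∀ t : ℂ, WInvariants (wCut + t • cutAB f) (3 + 3 * Complex.normSq t) := fun t => by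
    have := (hW t).wInvariants.1
    rwa [hN] at this
  have hAC : ∀ t : ℂ, WInvariants (wCut + t • cutAC f) (3 + 3 * Complex.normSq t) := fun t => by
    have := (hW t).wInvariants.2.1
    rwa [hN, show cutAC (wVec + t • f) = cutAC wVec + t • cutAC f from rfl, cutAC_wVec] at this
  have hBC : ∀ t : ℂ, WInvariants (wCut + t • cutBC f) (3 + 3 * Complex.normSq t) := fun t => by
    have := (hW t).wInvariants.2.2
    rwa [hN, show cutBC (wVec + t • f) = cutBC wVec + t • cutBC f from rfl, cutBC_wVec] at this
  obtain ⟨h111, s1⟩ := WInvariants.first_order hAB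
  have s2 := (WInvariants.first_order hAC).2
  have s3 := (WInvariants.first_order hBC).2
  simp only [cutAB, cutAC, cutBC] at h111 s1 s2 s3
  -- The three cuts say that the W amplitudes of f sum to zero in pairs, hence vanish.
  have h010 : f (0, 1, 0) = 0 := by linear_combination (s1 - s2 + s3) / 2
  have h100 : f (1, 0, 0) = 0 := by linear_combination (s1 + s2 - s3) / 2
  have h001 : f (0, 0, 1) = 0 := by linear_combination (s2 + s3 - s1) / 2
  obtain ⟨-, n1, q1⟩ := WInvariants.second_order hAB h010 h100 h001 h111
  obtain ⟨z2, n2, -⟩ := WInvariants.second_order hAC h001 h100 h010 h111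
  obtain ⟨-, n3, -⟩ := WInvariants.second_order hBC h001 h010 h100 h111
  simp only [cutAB, cutAC, cutBC, map_mul] at n1 q1 z2 n2 n3
  have p1 := Complex.normSq_nonneg (f (0, 1, 1))
  have p2 := Complex.normSq_nonneg (f (1, 0, 1))
  have p3 := Complex.normSq_nonneg (f (1, 1, 0))
  have hb : Complex.normSq (f (0, 1, 1)) = 1 := by
    have e : Complex.normSq (f (0, 1, 1)) ^ 2 = 1 := by
      linear_combination -(Complex.normSq (f (0, 1, 1))) ^ 2 * n3 +
        (Complex.normSq (f (0, 1, 1)) * Complex.normSq (f (1, 1, 0))) * n1 + n2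
    exact (pow_eq_one_iff_of_nonneg p1 two_ne_zero).1 e
  rw [hb, one_mul] at n1 n2
  -- If b = c, then (d − 2b)² = 4b² gives d = 0 or d = 4b, against |d| = |b| = 1.
  have hbc : f (0, 1, 1) ≠ f (1, 0, 1) := by
    intro h
    rw [← h] at q1
    have e : f (1, 1, 0) * (f (1, 1, 0) - 4 * f (0, 1, 1)) = 0 := by linear_combination q1
    rcases mul_eq_zero.1 e with e | e
    · simp [e] at n2
    · rw [sub_eq_zero.1 e, map_mul, hb] at n2
      norm_num [Complex.normSq_apply] at n2
  have h000 : f (0, 0, 0) = 0 := by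
    refine (mul_eq_zero.1 z2).resolve_right fun e => ?_
    simp [e] at n1
  have hrAB := hasRoof_reducedAB_pair h000 h010 h001 h111 hb n1
  have hrAC := (hasRoof_mul_conjTranspose (cutAC wVec)).add (hasRoof_mul_conjTranspose (cutAC f))
  have hrBC := (hasRoof_mul_conjTranspose (cutBC wVec)).add (hasRoof_mul_conjTranspose (cutBC f))
  rw [← reducedAC_ketBra, ← reducedAC_ketBra, ← reducedAC_add] at hrAC
  rw [← reducedBC_ketBra, ← reducedBC_ketBra, ← reducedBC_add] at hrBC
  -- AC and BC contribute 2 from W and 2 from f each, so 8 in total, and AB contributes less than 4.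
  refine ⟨_, ?_, _, _, _, hrAB, hrAC, hrBC, le_rfl⟩
  have hlt := norm_add_lt_two hb n1 hbc
  have m1 : ‖f (0, 1, 1)‖ = 1 := by
    rw [Complex.normSq_eq_norm_sq] at hb
    exact (pow_eq_one_iff_of_nonneg (norm_nonneg _) two_ne_zero).1 hb
  have m2 : ‖f (1, 0, 1)‖ = 1 := by
    rw [Complex.normSq_eq_norm_sq] at n1
    exact (pow_eq_one_iff_of_nonneg (norm_nonneg _) two_ne_zero).1 n1
  have m3 : ‖f (1, 1, 0)‖ = 1 := by
    rw [Complex.normSq_eq_norm_sq] at n2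
    exact (pow_eq_one_iff_of_nonneg (norm_nonneg _) two_ne_zero).1 n2
  simp [spinFlip, cutAC, cutBC, wVec, h000, h001, h010, h100, h111, m1, m2, m3]
  linarith

/-- The bound 4m is what two separate pure bounds give. If it could not be beaten, every rotated
pair would saturate both, so the whole span would be W-type; a local operator then moves ψ to
`wVec`. -/
lemma exists_lt_totalRoof_pair {ψ φ : ThreeQubit → ℂ} {m : ℝ} (hm : 0 < m)
    (hψ : ∑ x, ‖ψ x‖ ^ 2 = m) (hφ : ∑ x, ‖φ x‖ ^ 2 = m) (horth : star ψ ⬝ᵥ φ = 0) :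
    ∃ c < 4 * m, TotalRoof (ketBra ψ + ketBra φ) c := by
  by_contra! hcon
  have hunit : ∀ s t : ℂ, ‖s‖ ^ 2 + ‖t‖ ^ 2 = 1 → IsWType (s • ψ + t • φ) := by
    intro s t hst
    obtain ⟨c, hc, hr, hw⟩ := exists_totalRoof_ketBra (s • ψ + t • φ)
    obtain ⟨d, hd, hr', -⟩ := exists_totalRoof_ketBra (-star t • ψ + star s • φ)
    rw [sum_norm_sq_smul_add_smul horth, hψ, hφ, ← add_mul, hst, one_mul] at hc hw
    rw [sum_norm_sq_smul_add_smul horth, hψ, hφ, ← add_mul, norm_neg, norm_star, norm_star,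
      add_comm (‖t‖ ^ 2), hst, one_mul] at hd
    have hsum := hr.add hr'
    rw [ketBra_add_ketBra_rotate hst] at hsum
    refine hw (le_antisymm hc (not_lt.1 fun hlt => hcon (c + d) (by linarith) hsum))
  have hall : ∀ t : ℂ, IsWType (ψ + t • φ) := by
    intro t
    obtain ⟨k, hk⟩ := exists_smul_normalized (x := 1) (y := t) (Or.inl one_ne_zero)
    have hk0 : k ≠ 0 := by rintro rfl; simp at hk
    have := (hunit _ _ hk).smul k⁻¹
    simpa [smul_add, smul_smul, hk0] using this
  obtain ⟨s, U₁, U₂, U₃, h₁, h₂, h₃, hs⟩ := (by simpa using hall 0 : IsWType ψ)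
  have hsm := sum_norm_sq_localOp s h₁ h₂ h₃ wVec
  rw [← hs, hψ, sum_norm_sq_wVec] at hsm
  have hs0 : s ≠ 0 := by rintro rfl; simp at hsm; linarith
  have hsn : ‖s‖ ^ 2 ≠ 0 := by positivity
  have hinv := localOp_star_mul_localOp hs0 h₁ h₂ h₃
  have hinv' := mul_eq_one_comm.1 hinv
  set f := localOp s⁻¹ (star U₁) (star U₂) (star U₃) *ᵥ φ with hf
  have hφf : φ = localOp s U₁ U₂ U₃ *ᵥ f := by
    rw [hf, Matrix.mulVec_mulVec, hinv', Matrix.one_mulVec]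
  have hfn := sum_norm_sq_localOp s h₁ h₂ h₃ f
  rw [← hφf, hφ, hsm] at hfn
  have hfo := dotProduct_localOp s h₁ h₂ h₃ wVec f
  rw [← hs, ← hφf, horth] at hfo
  obtain ⟨c, hc, hr⟩ := exists_lt_totalRoof_wVec_add (f := f)
    (fun t => by
      have := (hall t).localOp s⁻¹ (Unitary.star_mem h₁) (Unitary.star_mem h₂)
        (Unitary.star_mem h₃)
      rwa [Matrix.mulVec_add, Matrix.mulVec_smul, ← hf, hs, Matrix.mulVec_mulVec, hinv,
        Matrix.one_mulVec] at this)
    ((mul_eq_zero.1 hfo.symm).resolve_left (by exact_mod_cast hsn))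
    (mul_left_cancel₀ hsn hfn).symm
  have := hr.localOp_pair s h₁ h₂ h₃
  rw [← hs, ← hφf] at this
  refine hcon _ ?_ this
  have hpos : 0 < ‖s‖ ^ 2 := by positivity
  nlinarith

/-! ### Spectral decomposition and the lower bound for W. -/

lemma Matrix.PosSemidef.exists_eq_sum_ketBra {ι : Type*} [Fintype ι] [DecidableEq ι]
    {ρ : Matrix ι ι ℂ} (h : ρ.PosSemidef) :
    ∃ (l : ι → ℝ) (u : ι → ι → ℂ), (∀ i, 0 ≤ l i) ∧
      (∀ i j, star (u i) ⬝ᵥ u j = if i = j then 1 else 0) ∧ ρ = ∑ i, (l i : ℂ) • ketBra (u i) := by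
  refine ⟨h.isHermitian.eigenvalues, fun i j => h.isHermitian.eigenvectorUnitary.1 j i,
    h.eigenvalues_nonneg, fun i j => ?_, ?_⟩
  · have := congrFun (congrFun
      (Matrix.mem_unitaryGroup_iff'.1 h.isHermitian.eigenvectorUnitary.2) i) j
    simpa [Matrix.mul_apply, dotProduct, Matrix.one_apply] using this
  · conv_lhs => rw [h.isHermitian.spectral_theorem]
    ext a b
    simp [Unitary.conjStarAlgAut_apply, Matrix.mul_apply, Matrix.sum_apply, ketBra,
      Matrix.vecMulVec_apply, Matrix.diagonal_apply]
    exact Finset.sum_congr rfl fun i _ => by ring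

lemma totalRoof_smul_ketBra {r : ℝ} (hr : 0 ≤ r) (ψ : ThreeQubit → ℂ) :
    TotalRoof ((r : ℂ) • ketBra ψ) (2 * (r * ∑ x, ‖ψ x‖ ^ 2)) := by
  have hs : ‖((Real.sqrt r : ℝ) : ℂ)‖ ^ 2 = r := by
    rw [Complex.norm_real, Real.norm_eq_abs, sq_abs, Real.sq_sqrt hr]
  obtain ⟨c, hc, h, -⟩ := exists_totalRoof_ketBra (((Real.sqrt r : ℝ) : ℂ) • ψ)
  rw [ketBra_smul, hs] at h
  refine h.mono (hc.trans (le_of_eq ?_))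
  simp only [Pi.smul_apply, smul_eq_mul, norm_mul, mul_pow, hs, ← Finset.mul_sum]

/-- The zero entry at (11, 11) forces χ(1,1) = 0 in every term of positive weight, so `spinFlip` is
−2χ(0,1)χ(1,0) there. The triangle inequality on the entry (01, 10), equal to 1/3, finishes. -/
lemma two_thirds_le_sum_of_decomposition {k : ℕ} {p : Fin k → ℝ} {χ : Fin k → Qubit × Qubit → ℂ}
    (hp : ∀ i, 0 ≤ p i)
    (h : (1 / 3 : ℂ) • (wCut * wCutᴴ) = ∑ i, (p i : ℂ) • ketBra (χ i)) :
    2 / 3 ≤ ∑ i, p i * ‖spinFlip (χ i)‖ := by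
  have h11 := congrFun (congrFun h (1, 1)) (1, 1)
  have h01 := congrFun (congrFun h (0, 1)) (1, 0)
  simp [Matrix.sum_apply, ketBra, Matrix.vecMulVec_apply, Matrix.mul_apply, wCut,
    cutAB, wVec, Complex.mul_conj'] at h11 h01
  have h11' : ∑ i, p i * ‖χ i (1, 1)‖ ^ 2 = 0 := by exact_mod_cast h11.symm
  have hz : ∀ i, p i * ‖χ i (1, 1)‖ ^ 2 = 0 := fun i =>
    (Finset.sum_eq_zero_iff_of_nonneg fun i _ => mul_nonneg (hp i) (by positivity)).1 h11' i
      (Finset.mem_univ i)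
  have hn : (1 / 3 : ℝ) ≤ ∑ i, p i * (‖χ i (0, 1)‖ * ‖χ i (1, 0)‖) := by
    have := norm_sum_le Finset.univ
      fun i => (p i : ℂ) * (χ i (0, 1) * (starRingEnd ℂ) (χ i (1, 0)))
    rw [← h01] at this
    simpa [abs_of_nonneg (hp _)] using this
  have heq : ∀ i, p i * ‖spinFlip (χ i)‖ = 2 * (p i * (‖χ i (0, 1)‖ * ‖χ i (1, 0)‖)) := by
    intro i
    rcases mul_eq_zero.1 (hz i) with h0 | h0
    · simp [h0]
    · have h0' : χ i (1, 1) = 0 := by simpa using h0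
      simp [spinFlip, h0']
      ring
  rw [Finset.sum_congr rfl fun i _ => heq i, ← Finset.mul_sum]
  linarith

lemma two_thirds_le_concurrence {U V : Matrix Qubit Qubit ℂ}
    (hU : U ∈ Matrix.unitaryGroup Qubit ℂ) (hV : V ∈ Matrix.unitaryGroup Qubit ℂ) {s : ℂ}
    (hs : ‖s‖ ^ 2 = 1 / 3) {σ : Matrix (Qubit × Qubit) (Qubit × Qubit) ℂ}
    (hσ : σ = (s • U ⊗ₖ V) * (wCut * wCutᴴ) * (s • U ⊗ₖ V)ᴴ) (htr : σ.trace = 1) :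
    2 / 3 ≤ concurrence σ := by
  have hUV : star U ⊗ₖ star V * U ⊗ₖ V = (1 : Matrix (Qubit × Qubit) (Qubit × Qubit) ℂ) := by
    rw [← Matrix.mul_kronecker_mul, Matrix.mem_unitaryGroup_iff'.1 hU,
      Matrix.mem_unitaryGroup_iff'.1 hV, Matrix.one_kronecker_one]
  have hUV' : (U ⊗ₖ V)ᴴ * (star U ⊗ₖ star V)ᴴ = 1 := by
    rw [← Matrix.conjTranspose_mul, hUV, Matrix.conjTranspose_one]
  refine le_csInf ?_ ?_
  -- A decomposition must exist, since the infimum of the empty set would be 0.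
  · have hr := (hasRoof_mul_conjTranspose wCut).conj s hU hV
    rw [← hσ] at hr
    obtain ⟨k, p, φ, hd, -⟩ := hr.exists_isPureDecomposition htr
    exact ⟨_, k, p, φ, hd, rfl⟩
  · rintro _ ⟨k, p, φ, hd, rfl⟩
    have hσ' : (star U ⊗ₖ star V) * σ * (star U ⊗ₖ star V)ᴴ = (1 / 3 : ℂ) • (wCut * wCutᴴ) := by
      have hss : s * star s = 1 / 3 := by
        rw [Complex.star_def, Complex.mul_conj', ← Complex.ofReal_pow, hs]; norm_num
      calc (star U ⊗ₖ star V) * σ * (star U ⊗ₖ star V)ᴴ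
          = (s * star s) • ((star U ⊗ₖ star V * U ⊗ₖ V) * (wCut * wCutᴴ) *
            ((U ⊗ₖ V)ᴴ * (star U ⊗ₖ star V)ᴴ)) := by
            rw [hσ, Matrix.conjTranspose_smul]
            simp only [Matrix.smul_mul, Matrix.mul_smul, smul_smul, Matrix.mul_assoc]
            rw [mul_comm]
        _ = _ := by rw [hUV, hUV', Matrix.one_mul, Matrix.mul_one, hss]
    have := two_thirds_le_sum_of_decomposition hd.nonneg
      (χ := fun i => (star U ⊗ₖ star V) *ᵥ φ i) (by
        rw [← hσ', hd.eq_sum, Matrix.mul_sum, Matrix.sum_mul]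
        simp only [ketBra_mulVec, Matrix.mul_smul, Matrix.smul_mul])
    refine this.trans (le_of_eq (Finset.sum_congr rfl fun i _ => ?_))
    rw [pureConcurrence_eq_norm_spinFlip _ (hd.isPureState i), spinFlip_kronecker_mulVec, norm_mul,
      norm_mul, norm_det_of_mem_unitaryGroup (Unitary.star_mem hU),
      norm_det_of_mem_unitaryGroup (Unitary.star_mem hV), one_mul, one_mul]

/-! ### The equality case and the theorem. -/

lemma localUnitaryEquiv_wState_iff {ρ : Matrix ThreeQubit ThreeQubit ℂ} :
    LocalUnitaryEquiv ρ (ketBra wState) ↔ ∃ U₁ ∈ Matrix.unitaryGroup Qubit ℂ,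
      ∃ U₂ ∈ Matrix.unitaryGroup Qubit ℂ, ∃ U₃ ∈ Matrix.unitaryGroup Qubit ℂ,
        ρ = ketBra (localOp ((1 / Real.sqrt 3 : ℝ) : ℂ) U₁ U₂ U₃ *ᵥ wVec) := by
  have hw : wState = ((1 / Real.sqrt 3 : ℝ) : ℂ) • wVec := by
    funext x
    simp only [wState, wVec, Pi.smul_apply, smul_eq_mul, mul_ite, mul_one, mul_zero]
  have h : ∀ U₁ U₂ U₃ : Matrix Qubit Qubit ℂ,
      localOp ((1 / Real.sqrt 3 : ℝ) : ℂ) U₁ U₂ U₃ *ᵥ wVec = (U₁ ⊗ₖ (U₂ ⊗ₖ U₃)) *ᵥ wState := by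
    intro U₁ U₂ U₃
    rw [hw, localOp, Matrix.mulVec_smul, Matrix.smul_mulVec]
  simp only [LocalUnitaryEquiv, h, ketBra_mulVec]

lemma two_le_sumConcurrence {ρ : Matrix ThreeQubit ThreeQubit ℂ} (htr : ρ.trace = 1)
    (h : LocalUnitaryEquiv ρ (ketBra wState)) : 2 ≤ sumConcurrence ρ := by
  obtain ⟨U₁, h₁, U₂, h₂, U₃, h₃, hρ⟩ := localUnitaryEquiv_wState_iff.1 h
  have hs : ‖((1 / Real.sqrt 3 : ℝ) : ℂ)‖ ^ 2 = 1 / 3 := by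
    rw [Complex.norm_real, Real.norm_eq_abs, sq_abs, div_pow, Real.sq_sqrt (by norm_num), one_pow]
  have kAB := two_thirds_le_concurrence (σ := reducedAB ρ) h₁ h₂ hs
    (by rw [hρ, reducedAB_localOp _ h₃, reducedAB_ketBra]; rfl) (by rw [trace_reducedAB, htr])
  have kAC := two_thirds_le_concurrence (σ := reducedAC ρ) h₁ h₃ hs
    (by rw [hρ, reducedAC_localOp _ h₂, reducedAC_ketBra, cutAC_wVec])
    (by rw [trace_reducedAC, htr])
  have kBC := two_thirds_le_concurrence (σ := reducedBC ρ) h₂ h₃ hs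
    (by rw [hρ, reducedBC_localOp _ h₁, reducedBC_ketBra, cutBC_wVec])
    (by rw [trace_reducedBC, htr])
  unfold sumConcurrence
  linarith

lemma IsWType.localUnitaryEquiv {ψ : ThreeQubit → ℂ} (h : IsWType ψ)
    (hψ : ∑ x, ‖ψ x‖ ^ 2 = 1) : LocalUnitaryEquiv (ketBra ψ) (ketBra wState) := by
  obtain ⟨s, U₁, U₂, U₃, h₁, h₂, h₃, rfl⟩ := h
  rw [sum_norm_sq_localOp s h₁ h₂ h₃, sum_norm_sq_wVec] at hψ
  refine localUnitaryEquiv_wState_iff.2 ⟨U₁, h₁, U₂, h₂, U₃, h₃, ?_⟩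
  rw [_root_.localOp, _root_.localOp, Matrix.smul_mulVec, Matrix.smul_mulVec,
    ketBra_smul, ketBra_smul, Complex.norm_real, Real.norm_eq_abs, sq_abs, div_pow, Real.sq_sqrt (by norm_num), one_pow,
    show ‖s‖ ^ 2 = 1 / 3 by linarith]

/-- Two nonzero eigenvalues would allow splitting off m(|uᵢ⟩⟨uᵢ| + |uⱼ⟩⟨uⱼ|), with m the smaller
one. That part costs less than 4m and the rest at most 2(1 − 2m), so the total is below 2. Hence ρ
is pure and the pure equality case applies. -/
lemma localUnitaryEquiv_of_totalRoof {ρ : Matrix ThreeQubit ThreeQubit ℂ} (hρ : IsDensityMatrix ρ)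
    (h : ∀ c, TotalRoof ρ c → 2 ≤ c) : LocalUnitaryEquiv ρ (ketBra wState) := by
  obtain ⟨l, u, hl, hu, hsum⟩ := hρ.posSemidef.exists_eq_sum_ketBra
  have hun : ∀ i, ∑ x, ‖u i x‖ ^ 2 = 1 := fun i => by
    have := hu i i
    rw [← sum_norm_sq_eq_dotProduct, if_pos rfl] at this
    exact_mod_cast this
  have hl1 : ∑ i, l i = 1 := by
    have := hρ.trace_eq_one
    rw [hsum, Matrix.trace_sum] at this
    simp only [Matrix.trace_smul, trace_ketBra, hun, Complex.ofReal_one, smul_eq_mul,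
      mul_one] at this
    exact_mod_cast this
  obtain ⟨i, hi⟩ : ∃ i, l i ≠ 0 := by
    by_contra! h0
    simp [h0] at hl1
  by_cases hj : ∃ j, j ≠ i ∧ l j ≠ 0
  · exfalso
    obtain ⟨j, hji, hj⟩ := hj
    set m := min (l i) (l j) with hm
    have hm0 : 0 < m := lt_min ((hl i).lt_of_ne' hi) ((hl j).lt_of_ne' hj)
    have hsq : ‖((Real.sqrt m : ℝ) : ℂ)‖ ^ 2 = m := by
      rw [Complex.norm_real, Real.norm_eq_abs, sq_abs, Real.sq_sqrt hm0.le]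
    have hnorm : ∀ a, ∑ x, ‖(((Real.sqrt m : ℝ) : ℂ) • u a) x‖ ^ 2 = m := fun a => by
      simp only [Pi.smul_apply, smul_eq_mul, norm_mul, mul_pow, hsq, ← Finset.mul_sum, hun, mul_one]
    obtain ⟨c, hc, hr⟩ := exists_lt_totalRoof_pair hm0 (hnorm i) (hnorm j)
      (by simp [hu i j, hji.symm])
    rw [ketBra_smul, ketBra_smul, hsq] at hr
    let μ : ThreeQubit → ℝ := fun a => l a - (if a = i then m else 0) - (if a = j then m else 0)
    have hμ : ∀ a, 0 ≤ μ a := by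
      intro a
      have e1 := min_le_left (l i) (l j)
      have e2 := min_le_right (l i) (l j)
      have e3 := hl a
      simp only [μ]
      by_cases ha : a = i
      · subst ha; simp [hji.symm]; linarith
      · by_cases hb : a = j
        · subst hb; simp [hji]; linarith
        · simp [ha, hb, e3]
    have hrest := TotalRoof.sum Finset.univ fun a _ => totalRoof_smul_ketBra (hμ a) (u a)
    have hdec : (m : ℂ) • ketBra (u i) + (m : ℂ) • ketBra (u j) +
        ∑ a, (μ a : ℂ) • ketBra (u a) = ρ := by
      rw [hsum]
      simp only [μ, Complex.ofReal_sub, sub_smul, Finset.sum_sub_distrib, apply_ite Complex.ofReal,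
        Complex.ofReal_zero, ite_smul, zero_smul, Finset.sum_ite_eq', Finset.mem_univ, if_true]
      abel
    have hμ1 : ∑ a, μ a = 1 - 2 * m := by
      simp only [μ, Finset.sum_sub_distrib, Finset.sum_ite_eq', Finset.mem_univ, if_true, hl1]
      ring
    have htot := hr.add hrest
    rw [hdec, ← Finset.mul_sum] at htot
    simp only [hun, mul_one, hμ1] at htot
    have := h _ htot
    linarith
  · push Not at hj
    have hli : l i = 1 := by
      rwa [Finset.sum_eq_single i (fun j _ hji => hj j hji) (by simp)] at hl1
    have hρi : ρ = ketBra (u i) := by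
      rw [hsum, Finset.sum_eq_single i (fun j _ hji => by simp [hj j hji]) (by simp), hli]
      simp
    obtain ⟨c, hc, hr, hw⟩ := exists_totalRoof_ketBra (u i)
    rw [← hρi] at hr
    rw [hun, mul_one] at hc hw
    rw [hρi]
    exact (hw (le_antisymm hc (h c hr))).localUnitaryEquiv (hun i)

lemma Matrix.PosSemidef.totalRoof {ρ : Matrix ThreeQubit ThreeQubit ℂ} (h : ρ.PosSemidef) :
    TotalRoof ρ (2 * ρ.trace.re) := by
  obtain ⟨l, u, hl, hu, hsum⟩ := h.exists_eq_sum_ketBra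
  have := TotalRoof.sum Finset.univ fun a _ => totalRoof_smul_ketBra (hl a) (u a)
  rw [← hsum, ← Finset.mul_sum] at this
  refine this.mono (le_of_eq ?_)
  rw [hsum, Matrix.trace_sum]
  simp only [Matrix.trace_smul, trace_ketBra, smul_eq_mul, ← Complex.ofReal_mul,
    ← Complex.ofReal_sum, Complex.ofReal_re]

theorem theorem2 (ρ : Matrix ThreeQubit ThreeQubit ℂ) (hρ : IsDensityMatrix ρ) :
    sumConcurrence ρ ≤ 2 ∧
      (sumConcurrence ρ = 2 ↔ LocalUnitaryEquiv ρ (ketBra wState)) := by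
  have hle : sumConcurrence ρ ≤ 2 := by
    refine hρ.posSemidef.totalRoof.sumConcurrence_le hρ.trace_eq_one |>.trans ?_
    simp [hρ.trace_eq_one]
  refine ⟨hle, fun h => ?_, fun h => le_antisymm hle (two_le_sumConcurrence hρ.trace_eq_one h)⟩
  exact localUnitaryEquiv_of_totalRoof hρ fun c hc => h ▸ hc.sumConcurrence_le hρ.trace_eq_one
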